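/- Let $X\subset\mathbb R^n$ be open, bounded and convex, let $q>1$, let $\gamma:X\to\mathbb R$ be Lipschitz continuous with $\gamma\ge\lambda$ on $X$ for some constant $\lambda>0$, and let $a_0\in\mathbb R$, $y_0\in\mathbb R^n$. Put $$U_0=\{u:X\to\mathbb R \;:\; u \text{ is convex and } u(x)\ge a_0+x\cdot y_0 \text{ for all } x\in X\},$$ $$L(u)=\int_X\Big(\frac1q|Du|^q-x\cdot Du+u\Big)\gamma(x)\,dx\in(-\infty,+\infty],\qquad u\in U_0 .$$ Let $u$ be a minimizer of $L$ in $U_0$. Then $u\in C^{1,\alpha}_{\mathrm{loc}}(X)$, that is, $u\in C^1(X)$ and $Du$ is $\alpha$-Hölder continuous on every compact subset of $X$, where $\alpha=\frac1{q-1}$ if $q>2$ and $\alpha=1$ if $1<q\le 2$. -/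

import Mathlib

open MeasureTheory
open scoped NNReal

noncomputable section

namespace RochetChone

/-- The admissible class `U₀`: functions that are convex on `X` and satisfy `u(x) ≥ a₀ + x · y₀`
there. Functions are total, but only their values on `X` matter. -/
def Admissible {n : ℕ} (X : Set (EuclideanSpace ℝ (Fin n))) (a₀ : ℝ)
    (y₀ : EuclideanSpace ℝ (Fin n)) : Set (EuclideanSpace ℝ (Fin n) → ℝ) :=
  {u | ConvexOn ℝ X u ∧ ∀ x ∈ X, a₀ + inner ℝ x y₀ ≤ u x}

/-- The integrand `(|Du|^q / q - x · Du + u) γ(x)`. A convex function is differentiable at almost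
every point of an open set, so the value of `gradient` elsewhere is immaterial. -/
def integrand {n : ℕ} (q : ℝ) (γ u : EuclideanSpace ℝ (Fin n) → ℝ)
    (x : EuclideanSpace ℝ (Fin n)) : ℝ :=
  (‖gradient u x‖ ^ q / q - inner ℝ x (gradient u x) + u x) * γ x

/-- The functional `L(u) = ∫_X (|Du|^q / q - x · Du + u) γ(x) dx`. -/
def energy {n : ℕ} (q : ℝ) (γ : EuclideanSpace ℝ (Fin n) → ℝ)
    (X : Set (EuclideanSpace ℝ (Fin n))) (u : EuclideanSpace ℝ (Fin n) → ℝ) : ℝ :=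
  ∫ x in X, integrand q γ u x

/-- `u` minimizes the functional over `U₀`. For bounded `X`, bounded `γ ≥ 0` and admissible `v` the
integrand is bounded below on `X`, so it either is integrable or has integral `+∞`; the affine
function `a₀ + x · y₀` has finite energy. Hence a minimizer in the sense of `(-∞, +∞]`-valued
integrals is an admissible function of finite energy that does at least as well as every
competitor of finite energy. -/
structure IsMinimizer {n : ℕ} (q : ℝ) (γ : EuclideanSpace ℝ (Fin n) → ℝ)
    (X : Set (EuclideanSpace ℝ (Fin n))) (a₀ : ℝ) (y₀ : EuclideanSpace ℝ (Fin n))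
    (u : EuclideanSpace ℝ (Fin n) → ℝ) : Prop where
  mem : u ∈ Admissible X a₀ y₀
  integrable : IntegrableOn (integrand q γ u) X
  le : ∀ v ∈ Admissible X a₀ y₀, IntegrableOn (integrand q γ v) X →
    energy q γ X u ≤ energy q γ X v

/-- `u ∈ C^{1,α}_loc(X)` for an open set `X`: `u` is `C¹` in `X`, and its gradient is
`α`-Hölder continuous on every compact subset of `X`. -/
def IsC1HolderLoc {n : ℕ} (α : ℝ≥0) (u : EuclideanSpace ℝ (Fin n) → ℝ)
    (X : Set (EuclideanSpace ℝ (Fin n))) : Prop :=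
  ContDiffOn ℝ 1 u X ∧
    ∀ K ⊆ X, IsCompact K → ∃ C : ℝ≥0, HolderOnWith C α (gradient u) K

end RochetChone

end

/-!
Regularity of minimizers follows from comparing a minimizer `u` with the maxima of `u` and affine
functions.

Let `x₀ ∈ X` and let `w ≥ 0` be `u` minus a supporting affine function at `x₀`. If `w` attains its
maximum `h` over the ball of radius `r` about `x₀` at `x₁`, then `x₁` lies on the sphere, and a
suitable affine function `ℓ` satisfies `ℓ - u = h / 2` at `x₀`, `ℓ - u ≤ h` on `X`, and exceeds `u`
only on a convex set `S` contained in a slab of width `2 r` (`exists_slab`). The function `max u ℓ`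
is admissible. With `p = ∇ℓ`, `f = ℓ - u`, and the field `b(x) = γ(x) (|p|^(q-2) p - x)`, minimality
yields
`∫_S (|∇u|^q / q - |p|^q / q - ⟪|p|^(q-2) p, ∇u - p⟫) γ ≤ ∫_S ⟪∇f, b⟫ + ∫_S f γ`.

* The right-hand side is at most a constant times `∫_S f ≤ h |S|`
  (`setIntegral_inner_le_of_lipschitzOnWith`). An integration by parts would produce an integral
  over the part of `∂X` that `S` may reach. Instead, `b` is split into a field pointing into `X`,
  whose flow maps `X` into itself and so does not increase `∫ f⁺` by much, and a multiple of the
  radial field `x - x₀`, for which `⟪∇f, x - x₀⟫ ≤ f` by concavity.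
* On the left, uniform convexity of `|·|^q` with power `m = max q 2` bounds the integrand below by
  `s^(m-1) (|∇f| - s)` up to a constant, for every bounded `s > 0` (`exists_norm_rpow_div_ge`). On
  the half-size copy of `S` about `x₀` one has `f ≥ h / 4`, and crossing the slab from there leads
  out of `S` inside `X`; hence the mean of `|∇f|` over `S` is at least a multiple of `h / r`
  (`mul_volume_le_integral_norm_gradient`).

Choosing `s` proportional to `h / r` gives `(h / r)^m ≤ C h`, that is, `h ≤ C r^(1 + 1 / (m - 1))`
(`IsMinimizer.exists_sub_tangent_le`). A convex function with this property, locally uniformly in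
`x₀`, is of class `C^{1,α}_loc` with `α = 1 / (m - 1)` (`isC1HolderLoc_of_tangent_le`).
-/

namespace RochetChone

open Filter Topology Set

/-! ### Subgradients and tangent inequalities of convex functions -/

section

variable {E : Type*} [NormedAddCommGroup E] [InnerProductSpace ℝ E]
  {X : Set E} {f u : E → ℝ}

/-- The tangent inequality for a concave function. -/
theorem le_add_inner_of_hasGradientAt [CompleteSpace E] (hf : ConcaveOn ℝ X f)
    {x y G : E} (hx : x ∈ X) (hy : y ∈ X) (hG : HasGradientAt f G x) :
    f y ≤ f x + inner ℝ G (y - x) := by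
  have hd : HasDerivAt (fun t : ℝ => f (x + t • (y - x))) (inner ℝ G (y - x)) 0 := by
    have h1 : HasDerivAt (fun t : ℝ => x + t • (y - x)) (y - x) 0 := by
      simpa using ((hasDerivAt_id (0 : ℝ)).smul_const (y - x)).const_add x
    have h2 : HasFDerivAt f (InnerProductSpace.toDual ℝ _ G) (x + (0 : ℝ) • (y - x)) := by
      simpa using hG.hasFDerivAt
    simpa [Function.comp_def] using h2.comp_hasDerivAt 0 h1
  have hlim := hd.tendsto_slope_zero_right
  have : f y - f x ≤ inner ℝ G (y - x) := by
    refine ge_of_tendsto hlim ?_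
    have : Ioo (0 : ℝ) 1 ∈ 𝓝[>] (0 : ℝ) := Ioo_mem_nhdsGT one_pos
    filter_upwards [this] with t ht
    have hc := hf.2 hx hy (by linarith [ht.2] : (0 : ℝ) ≤ 1 - t) ht.1.le (by ring)
    have e : (1 - t) • x + t • y = x + t • (y - x) := by module
    rw [e] at hc
    simp only [smul_eq_mul, zero_add, zero_smul, add_zero] at hc ⊢
    rw [inv_mul_eq_div, le_div_iff₀ ht.1]
    linarith
  linarith

/-- A discrete form of the fundamental theorem of calculus along a line which leaves `S = {f > 0}`.
Only in the step that leaves `S` is the gradient no bound for the decrease of `f`; there the chord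
to the point at distance `r` further along the line, where `f ≥ -B`, gives an error of at most
`B / r` times the step size. -/
theorem le_sum_indicator_norm_gradient [CompleteSpace E] {S : Set E}
    (hf : ConcaveOn ℝ X f) (hS : S = {x ∈ X | 0 < f x}) {x e : E} (he : ‖e‖ = 1)
    {r : ℝ} (hr : 0 < r) {N : ℕ} (hN : 0 < N) {B : ℝ}
    (hxX : ∀ t ∈ Icc (0 : ℝ) (3 * r), x + t • e ∈ X)
    (hlow : ∀ t ∈ Icc (0 : ℝ) (3 * r), -B ≤ f (x + t • e))
    (hx : x ∈ S) (hend : x + (2 * r) • e ∉ S) {G : E → E}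
    (hG : ∀ k : ℕ, x + (k * (2 * r / N)) • e ∈ S →
      HasGradientAt f (G (x + (k * (2 * r / N)) • e)) (x + (k * (2 * r / N)) • e)) :
    f x ≤ (2 * r / N) * (∑ k ∈ Finset.range N,
      S.indicator (fun y => ‖G y‖) (x + ((k + 1 : ℕ) * (2 * r / N)) • e)) +
        (2 * r / N) * (B / r) := by
  have hN' : (0 : ℝ) < N := by exact_mod_cast hN
  set τ : ℝ := 2 * r / N with hτ
  have hτ0 : 0 < τ := by positivity
  have hNτ : N * τ = 2 * r := by rw [hτ]; field_simp
  set y : ℕ → E := fun k => x + (k * τ) • e with hy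
  have hyt : ∀ k ≤ N, k * τ ∈ Icc (0 : ℝ) (2 * r) := fun k hk => by
    have : (k : ℝ) ≤ N := by exact_mod_cast hk
    refine ⟨by positivity, ?_⟩
    rw [← hNτ]; gcongr
  have hyX : ∀ k ≤ N, y k ∈ X := fun k hk =>
    hxX _ ⟨(hyt k hk).1, by linarith [(hyt k hk).2]⟩
  have hsucc : ∀ k : ℕ, y (k + 1) = y k + τ • e := fun k => by
    simp only [hy]; push_cast; module
  set A : E → ℝ := S.indicator (fun z => ‖G z‖) with hA
  have hA0 : ∀ z, 0 ≤ A z := fun z => indicator_nonneg (fun _ _ => norm_nonneg _) z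
  -- up to step `k`, the line either is still in `S` or has left it
  have main : ∀ k ≤ N, (y k ∈ S ∧ f x ≤ f (y k) + τ * ∑ j ∈ Finset.range k, A (y (j + 1))) ∨
      (f x ≤ τ * (∑ j ∈ Finset.range k, A (y (j + 1))) + τ * (B / r)) := by
    intro k
    induction k with
    | zero => intro _; left; simp [hy, hx]
    | succ k ih =>
      intro hk
      rw [Finset.sum_range_succ, mul_add]
      rcases ih (by lia) with ⟨hkS, hle⟩ | hle
      · by_cases hk1 : y (k + 1) ∈ S
        · left
          refine ⟨hk1, ?_⟩
          have h1 := le_add_inner_of_hasGradientAt hf (hyX _ hk) (hyX k (by lia)) (hG (k + 1) hk1)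
          change f (y k) ≤ f (y (k + 1)) + inner ℝ (G (y (k + 1))) (y k - y (k + 1)) at h1
          have h2 : inner ℝ (G (y (k + 1))) (y k - y (k + 1)) ≤ τ * A (y (k + 1)) := by
            refine (real_inner_le_norm _ _).trans (le_of_eq ?_)
            have e1 : y k - y (k + 1) = -(τ • e) := by rw [hsucc]; abel
            rw [e1, norm_neg, norm_smul, he, Real.norm_eq_abs, abs_of_pos hτ0, hA,
              indicator_of_mem hk1]
            ring
          linarith
        · right
          have hk1f : f (y (k + 1)) ≤ 0 := by
            rw [hS] at hk1
            exact not_lt.1 fun h => hk1 ⟨hyX _ hk, h⟩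
          have ht : (k + 1 : ℕ) * τ + r ∈ Icc (0 : ℝ) (3 * r) := by
            have := hyt _ hk
            exact ⟨by linarith [this.1], by linarith [this.2]⟩
          have h1 := hf.2 (hyX k (by lia)) (hxX _ ht)
            (by positivity : 0 ≤ r / (r + τ)) (by positivity : 0 ≤ τ / (r + τ))
            (by field_simp)
          have e1 : (r / (r + τ)) • y k + (τ / (r + τ)) • (x + ((k + 1 : ℕ) * τ + r) • e) =
              y (k + 1) := by
            have h3 : τ / (r + τ) = 1 - r / (r + τ) := by field_simp; ring
            have h4 : (r / (r + τ)) * (r + τ) = r := by field_simp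
            have h5 : (r / (r + τ)) • y k + (τ / (r + τ)) • (x + ((k + 1 : ℕ) * τ + r) • e) =
              y (k + 1) + (r - (r / (r + τ)) * (r + τ)) • e := by
              rw [h3]; simp only [hy]; push_cast; module
            rw [h5, h4]; simp
          rw [e1] at h1
          have h2 := hlow _ ht
          simp only [smul_eq_mul] at h1
          have h3 : r * f (y k) + τ * f (x + ((k + 1 : ℕ) * τ + r) • e) ≤ 0 := by
            have : r / (r + τ) * f (y k) + τ / (r + τ) * f (x + ((k + 1 : ℕ) * τ + r) • e) =
              (r * f (y k) + τ * f (x + ((k + 1 : ℕ) * τ + r) • e)) / (r + τ) := by ring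
            rw [this] at h1
            have h4 := h1.trans hk1f
            rw [div_le_iff₀ (by positivity)] at h4
            linarith
          have h4 : f (y k) ≤ τ * (B / r) := by
            rw [mul_div_assoc', le_div_iff₀ hr]
            nlinarith
          have := mul_nonneg hτ0.le (hA0 (y (k + 1)))
          linarith
      · right
        have := mul_nonneg hτ0.le (hA0 (y (k + 1)))
        linarith
  rcases main N le_rfl with ⟨h, -⟩ | h
  · exact absurd (by simpa only [hy, hNτ] using h) hend
  · exact h

variable [FiniteDimensional ℝ E]

/-- A convex function on an open convex set has a subgradient at every point: separate the point of
the graph from the strict epigraph. -/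
theorem exists_subgradient [CompleteSpace E] (hX : IsOpen X) (hu : ConvexOn ℝ X u)
    {x₀ : E} (hx₀ : x₀ ∈ X) :
    ∃ p : E, ∀ x ∈ X, u x₀ + inner ℝ p (x - x₀) ≤ u x := by
  set s : Set (E × ℝ) := {z | z.1 ∈ X ∧ u z.1 < z.2} with hs
  have hconv : Convex ℝ s := hu.convex_strict_epigraph
  have hopen : IsOpen s := by
    have hc : ContinuousOn (fun z : E × ℝ => u z.1 - z.2) (Prod.fst ⁻¹' X) :=
      ((hu.continuousOn hX).comp continuousOn_fst fun z hz => hz).sub continuousOn_snd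
    have := hc.isOpen_inter_preimage (hX.preimage continuous_fst) (isOpen_Iio (a := (0 : ℝ)))
    convert this using 1
    ext z
    simp [hs]
  have hnot : (x₀, u x₀) ∉ s := by simp [hs]
  obtain ⟨g, hg⟩ := geometric_hahn_banach_open_point hconv hopen hnot
  have hsplit : ∀ (x : E) (t : ℝ), g (x, t) = g (x, 0) + t * g (0, 1) := by
    intro x t
    have : ((x, t) : E × ℝ) = (x, 0) + t • (0, 1) := by simp
    rw [this, map_add, map_smul, smul_eq_mul]
  set c := g (0, 1) with hc
  have hcneg : c < 0 := by
    have := hg (x₀, u x₀ + 1) ⟨hx₀, by simp⟩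
    rw [hsplit, hsplit x₀ (u x₀)] at this
    linarith
  set G : StrongDual ℝ E :=
    g.comp (ContinuousLinearMap.inl ℝ E ℝ) with hG
  refine ⟨(-c)⁻¹ • (InnerProductSpace.toDual ℝ _).symm G, fun x hx => ?_⟩
  have hGx : ∀ y, G y = g (y, 0) := fun y => rfl
  have key : ∀ t, u x < t → g (x, 0) + t * c < g (x₀, 0) + u x₀ * c := by
    intro t ht
    have := hg (x, t) ⟨hx, ht⟩
    rwa [hsplit, hsplit x₀ (u x₀)] at this
  have key2 : g (x, 0) + u x * c ≤ g (x₀, 0) + u x₀ * c := by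
    refine le_of_forall_pos_le_add fun ε hε => ?_
    have := key (u x + ε / (-c)) (by have := div_pos hε (neg_pos.2 hcneg); linarith)
    have e : (u x + ε / (-c)) * c = u x * c - ε := by
      have := hcneg.ne
      field_simp
      ring
    rw [e] at this
    linarith
  rw [inner_smul_left, InnerProductSpace.toDual_symm_apply, map_sub, hGx, hGx]
  simp only [conj_trivial]
  have : (-c)⁻¹ * (g (x, 0) - g (x₀, 0)) ≤ u x - u x₀ := by
    rw [inv_mul_le_iff₀ (neg_pos.2 hcneg)]
    linarith
  linarith

variable [MeasurableSpace E] [BorelSpace E]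

/-- A convex function on an open set is differentiable almost everywhere (Rademacher). -/
theorem ae_differentiableAt (hX : IsOpen X) (hu : ConvexOn ℝ X u) :
    ∀ᵐ x ∂(volume : Measure E), x ∈ X → DifferentiableAt ℝ u x := by
  have hlip : ∀ x : E, ∃ (K : ℝ≥0) (t : Set E),
      x ∈ X → t ∈ 𝓝[X] x ∧ LipschitzOnWith K u t := by
    intro x
    by_cases hx : x ∈ X
    · obtain ⟨K, t, h⟩ := hu.locallyLipschitzOn hX hx
      exact ⟨K, t, fun _ => h⟩
    · exact ⟨0, ∅, fun h => absurd h hx⟩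
  choose K t ht using hlip
  have hnhds : ∀ x ∈ X, t x ∈ 𝓝 x := fun x hx => by
    have := (ht x hx).1
    rwa [hX.nhdsWithin_eq hx] at this
  obtain ⟨c, hcX, hc, hcov⟩ :=
    TopologicalSpace.countable_cover_nhdsWithin (s := X) (f := fun x => interior (t x))
      fun x hx => mem_nhdsWithin_of_mem_nhds (interior_mem_nhds.2 (hnhds x hx))
  have : ∀ᵐ x ∂(volume : Measure E),
      ∀ y ∈ c, x ∈ interior (t y) → DifferentiableAt ℝ u x := by
    rw [ae_ball_iff hc]
    intro y hy
    filter_upwards [((ht y (hcX hy)).2.mono interior_subset).ae_differentiableWithinAt_of_mem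
      (μ := volume)] with x hx hxi
    exact (hx hxi).differentiableAt (isOpen_interior.mem_nhds hxi)
  filter_upwards [this] with x hx hxX
  obtain ⟨y, hy, hxy⟩ := mem_iUnion₂.1 (hcov hxX)
  exact hx y hy hxy

end

/-! ### Transport estimate on superlevel sets of concave functions -/

section

variable {E : Type*} [NormedAddCommGroup E] [InnerProductSpace ℝ E] [FiniteDimensional ℝ E]
  [MeasurableSpace E] [BorelSpace E]

/-- An expansion by at least `K⁻¹` enlarges volumes by at least `K⁻ⁿ`. This is obtained from
Hausdorff measure, so no change of variables formula is needed. -/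
theorem volume_preimage_le_of_antilipschitzWith {T : E → E} {K : ℝ≥0} (hT : AntilipschitzWith K T)
    (s : Set E) :
    volume (T ⁻¹' s) ≤ (K ^ Module.finrank ℝ E : ℝ≥0) * volume s := by
  have := isAddHaarMeasure_hausdorffMeasure (E := E)
  have h := Measure.isAddLeftInvariant_eq_smul (volume : Measure E)
    (Measure.hausdorffMeasure (Module.finrank ℝ E) : Measure E)
  rw [h]
  simp only [Measure.smul_apply]
  rw [ENNReal.smul_def, ENNReal.smul_def, smul_eq_mul, smul_eq_mul, mul_left_comm]
  gcongr
  refine (hT.hausdorffMeasure_preimage_le (Nat.cast_nonneg _) s).trans ?_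
  simp

/-- Functional form of `volume_preimage_le_of_antilipschitzWith`. -/
theorem integral_comp_le_of_antilipschitzWith {T : E → E} {K : ℝ≥0} (hT : AntilipschitzWith K T)
    (hTc : Continuous T) {g : E → ℝ} (hg : Integrable g) (hg0 : 0 ≤ g) :
    Integrable (g ∘ T) ∧ ∫ x, g (T x) ≤ (K : ℝ) ^ Module.finrank ℝ E * ∫ x, g x := by
  have hle : Measure.map T volume ≤ (K ^ Module.finrank ℝ E : ℝ≥0) • (volume : Measure E) := by
    refine Measure.le_iff.2 fun s hs => ?_
    rw [Measure.map_apply hTc.measurable hs, Measure.smul_apply, ENNReal.smul_def, smul_eq_mul]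
    exact volume_preimage_le_of_antilipschitzWith hT s
  have hi : Integrable g ((K ^ Module.finrank ℝ E : ℝ≥0) • (volume : Measure E)) :=
    hg.smul_measure_nnreal
  have hi' := hi.mono_measure hle
  refine ⟨(integrable_map_measure hi'.1 hTc.aemeasurable).1 hi', ?_⟩
  rw [← integral_map hTc.aemeasurable hi'.1]
  refine (integral_mono_measure hle (Eventually.of_forall hg0) hi).trans ?_
  rw [integral_smul_nnreal_measure, NNReal.smul_def, smul_eq_mul]
  simp

/-- The growth rate at time `0` of the factor `(1 - t a)⁻ⁿ`. -/
theorem tendsto_inv_one_sub_mul_pow (a : ℝ) (n : ℕ) :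
    Tendsto (fun t : ℝ => t⁻¹ * (((1 - t * a)⁻¹) ^ n - 1)) (𝓝[>] 0) (𝓝 (n * a)) := by
  have h1 : HasDerivAt (fun t : ℝ => 1 - t * a) (-a) 0 := by
    simpa using ((hasDerivAt_id (0 : ℝ)).mul_const a).const_sub 1
  have h2 : HasDerivAt (fun t : ℝ => ((1 - t * a)⁻¹) ^ n) (n * a) 0 := by
    simpa using (h1.fun_inv (by simp)).fun_pow n
  simpa using h2.tendsto_slope_zero_right

variable [CompleteSpace E] {X S : Set E} {f : E → ℝ}

/-- First variation of `∫ f⁺` along the flow `x ↦ x + t (x₀ + e x - x)`, which maps `X` into itself.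
It replaces an integration by parts on `S = {f > 0}`: as no point of `X` is carried out of `X`, no
term on the boundary of `X` appears. -/
theorem setIntegral_inner_flow_le (hXo : IsOpen X) (hXb : Bornology.IsBounded X)
    (hf : ConcaveOn ℝ X f) {H : ℝ} (hH : ∀ x ∈ X, f x ≤ H) (hS : S = {x ∈ X | 0 < f x})
    {x₀ : E} {δ : ℝ} (hball : Metric.closedBall x₀ δ ⊆ X)
    {G : E → E} (hG : ∀ᵐ x, x ∈ S → HasGradientAt f (G x) x) (hGi : IntegrableOn G S)
    {e : E → E} {K : ℝ≥0} (he : LipschitzWith K e) (heδ : ∀ x ∈ X, ‖e x‖ ≤ δ) :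
    IntegrableOn f S ∧
    ∫ x in S, inner ℝ (G x) (x₀ + e x - x) ≤ Module.finrank ℝ E * (1 + K) * ∫ x in S, f x := by
  have hSX : S ⊆ X := by rw [hS]; exact fun x hx => hx.1
  have hfc : ContinuousOn f X := hf.continuousOn hXo
  have hSo : IsOpen S := by
    have := hfc.isOpen_inter_preimage hXo (isOpen_Ioi (a := (0 : ℝ)))
    rw [hS]; exact this
  have hSm := hSo.measurableSet
  have hSfin : volume S < ⊤ := (hXb.subset hSX).measure_lt_top
  have hfS : ∀ x ∈ S, 0 < f x := by rw [hS]; exact fun x hx => hx.2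
  have hfi : IntegrableOn f S := by
    refine IntegrableOn.of_bound hSfin ((hfc.mono hSX).aestronglyMeasurable hSm) H ?_
    filter_upwards [ae_restrict_mem hSm] with x hx
    rw [Real.norm_eq_abs, abs_of_pos (hfS x hx)]
    exact hH x (hSX hx)
  refine ⟨hfi, ?_⟩
  obtain ⟨m, hm⟩ : ∃ m : ℝ, ∀ y ∈ Metric.closedBall x₀ δ, m ≤ f y := by
    obtain ⟨m, hm⟩ := ((isCompact_closedBall x₀ δ).image_of_continuousOn
      (hfc.mono hball)).bddBelow
    exact ⟨m, fun y hy => hm (mem_image_of_mem f hy)⟩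
  set y : E → E := fun x => x₀ + e x with hy
  have hyball : ∀ x ∈ X, y x ∈ Metric.closedBall x₀ δ := fun x hx => by
    simpa [hy, dist_eq_norm] using heδ x hx
  have hyX : ∀ x ∈ X, y x ∈ X := fun x hx => hball (hyball x hx)
  have hyc : Continuous y := continuous_const.add he.continuous
  set T : ℝ → E → E := fun t x => x + t • (y x - x) with hT
  have hTc : ∀ t, Continuous (T t) := fun t => by fun_prop
  have hTX : ∀ t ∈ Ioo (0 : ℝ) 1, ∀ x ∈ X, T t x ∈ X := fun t ht x hx => by
    have := hf.1 hx (hyX x hx) (by linarith [ht.2] : (0 : ℝ) ≤ 1 - t) ht.1.le (by ring)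
    convert this using 1
    simp only [hT]; module
  set g : E → ℝ := S.indicator f with hg
  have hgi : Integrable g := (integrable_indicator_iff hSm).2 hfi
  have hg0 : 0 ≤ g := fun x => indicator_nonneg (fun x hx => (hfS x hx).le) x
  have hfg : ∀ x ∈ X, f x ≤ g x := fun x hx => by
    by_cases hxS : x ∈ S
    · simp [hg, hxS]
    · rw [hg, indicator_of_notMem hxS]
      rw [hS] at hxS
      exact not_lt.1 fun h => hxS ⟨hx, h⟩
  set a : ℝ := 1 + K with ha
  have ha0 : 0 < a := by positivity
  obtain ⟨D, hD⟩ : ∃ D : ℝ, ∀ x ∈ S, ‖y x - x‖ ≤ D := by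
    obtain ⟨D, hD⟩ := Metric.isBounded_iff.1 hXb
    exact ⟨D, fun x hx => by simpa [dist_eq_norm] using hD (hyX x (hSX hx)) (hSX hx)⟩
  set φ : ℝ → E → ℝ := fun t x => t⁻¹ * (f (T t x) - f x) with hφ
  -- Chords of a concave function bound the difference quotients from below, tangents from above.
  have hlow : ∀ t ∈ Ioo (0 : ℝ) 1, ∀ x ∈ S, m - H ≤ φ t x := fun t ht x hx => by
    have h1 := hf.2 (hSX hx) (hyX x (hSX hx)) (by linarith [ht.2] : (0 : ℝ) ≤ 1 - t) ht.1.le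
      (by ring)
    have e1 : (1 - t) • x + t • y x = T t x := by simp only [hT]; module
    rw [e1] at h1
    have h2 := hm _ (hyball x (hSX hx))
    have h3 := hH x (hSX hx)
    simp only [hφ, smul_eq_mul] at h1 ⊢
    rw [inv_mul_eq_div, le_div_iff₀ ht.1]
    nlinarith [ht.1]
  have hup : ∀ t ∈ Ioo (0 : ℝ) 1, ∀ x ∈ S, HasGradientAt f (G x) x →
      φ t x ≤ inner ℝ (G x) (y x - x) := fun t ht x hx hGx => by
    have h1 := le_add_inner_of_hasGradientAt hf (hSX hx) (hTX t ht x (hSX hx)) hGx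
    have e1 : T t x - x = t • (y x - x) := by simp only [hT]; module
    rw [e1, inner_smul_right] at h1
    simp only [hφ]
    rw [inv_mul_eq_div, div_le_iff₀ ht.1]
    linarith
  have hnear : Ioo (0 : ℝ) 1 ∈ 𝓝[>] (0 : ℝ) := Ioo_mem_nhdsGT one_pos
  have hφm : ∀ t ∈ Ioo (0 : ℝ) 1, AEStronglyMeasurable (φ t) (volume.restrict S) := fun t ht => by
    refine ContinuousOn.aestronglyMeasurable ?_ hSm
    have h1 : ContinuousOn (fun x => f (T t x)) S :=
      hfc.comp (hTc t).continuousOn fun x hx => hTX t ht x (hSX hx)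
    exact continuousOn_const.mul (h1.sub (hfc.mono hSX))
  have hφb : ∀ t ∈ Ioo (0 : ℝ) 1, ∀ᵐ x ∂(volume.restrict S), ‖φ t x‖ ≤ ‖G x‖ * D + |m - H| :=
    fun t ht => by
    filter_upwards [ae_restrict_mem hSm, ae_restrict_of_ae hG] with x hx hGx
    have h1 := hlow t ht x hx
    have h2 := hup t ht x hx (hGx hx)
    have h3 : inner ℝ (G x) (y x - x) ≤ ‖G x‖ * D :=
      (real_inner_le_norm _ _).trans (by gcongr; exact hD x hx)
    have hD0 : 0 ≤ D := (norm_nonneg _).trans (hD x hx)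
    rw [Real.norm_eq_abs, abs_le]
    constructor
    · have := neg_abs_le (m - H)
      have : 0 ≤ ‖G x‖ * D := by positivity
      linarith
    · have := abs_nonneg (m - H)
      linarith
  have hbi : Integrable (fun x => ‖G x‖ * D + |m - H|) (volume.restrict S) := by
    have : IsFiniteMeasure (volume.restrict S) := ⟨by simpa using hSfin⟩
    exact (hGi.norm.mul_const D).add (integrable_const _)
  have hlim : Tendsto (fun t => ∫ x in S, φ t x) (𝓝[>] 0)
      (𝓝 (∫ x in S, inner ℝ (G x) (y x - x))) := by
    refine tendsto_integral_filter_of_dominated_convergence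
      (fun x => ‖G x‖ * D + |m - H|) ?_ ?_ hbi ?_
    · filter_upwards [hnear] with t ht using hφm t ht
    · filter_upwards [hnear] with t ht using hφb t ht
    · filter_upwards [ae_restrict_mem hSm, ae_restrict_of_ae hG] with x hx hGx
      have h1 : HasDerivAt (fun t : ℝ => x + t • (y x - x)) (y x - x) 0 := by
        simpa using ((hasDerivAt_id (0 : ℝ)).smul_const (y x - x)).const_add x
      have h2 : HasFDerivAt f (InnerProductSpace.toDual ℝ _ (G x)) (x + (0 : ℝ) • (y x - x)) := by
        simpa using (hGx hx).hasFDerivAt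
      simpa [hφ, hT] using (h2.comp_hasDerivAt 0 h1).tendsto_slope_zero_right
  have hlim2 := (tendsto_inv_one_sub_mul_pow a (Module.finrank ℝ E)).mul_const (∫ x in S, f x)
  refine le_of_tendsto_of_tendsto hlim hlim2 ?_
  have hnear2 : Ioo (0 : ℝ) (a⁻¹) ∈ 𝓝[>] (0 : ℝ) := Ioo_mem_nhdsGT (by positivity)
  filter_upwards [hnear, hnear2] with t ht ht2
  have hta : 0 < 1 - t * a := by
    have := mul_lt_mul_of_pos_right ht2.2 ha0
    rw [inv_mul_cancel₀ ha0.ne'] at this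
    linarith
  -- `T t` contracts distances at most by the factor `1 - t a`
  have hanti : AntilipschitzWith (1 - t * a)⁻¹.toNNReal (T t) := by
    refine AntilipschitzWith.of_le_mul_dist fun p q => ?_
    rw [Real.coe_toNNReal _ (by positivity), inv_mul_eq_div, le_div_iff₀ hta, dist_eq_norm,
      dist_eq_norm]
    have e1 : p - q = (T t p - T t q) + t • ((p - q) - (e p - e q)) := by
      simp only [hT, hy]; module
    have h1 : ‖e p - e q‖ ≤ K * ‖p - q‖ := by
      simpa [dist_eq_norm] using he.dist_le_mul p q
    have h2 : ‖p - q‖ ≤ ‖T t p - T t q‖ + t * (‖p - q‖ + K * ‖p - q‖) := by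
      calc ‖p - q‖ = ‖(T t p - T t q) + t • ((p - q) - (e p - e q))‖ := by rw [← e1]
        _ ≤ ‖T t p - T t q‖ + ‖t • ((p - q) - (e p - e q))‖ := norm_add_le _ _
        _ ≤ _ := by
          rw [norm_smul, Real.norm_eq_abs, abs_of_pos ht.1]
          have := ht.1
          gcongr
          exact (norm_sub_le _ _).trans (by linarith)
    rw [ha]
    linarith
  obtain ⟨hi1, hi2⟩ := integral_comp_le_of_antilipschitzWith hanti (hTc t) hgi hg0
  have hgS : ∫ x, g x = ∫ x in S, f x := integral_indicator hSm
  have hφi : IntegrableOn (φ t) S := Integrable.mono' hbi (hφm t ht) (hφb t ht)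
  calc ∫ x in S, φ t x ≤ ∫ x in S, t⁻¹ * (g (T t x) - f x) := by
        refine setIntegral_mono_on hφi ?_ hSm fun x hx => ?_
        · exact (hi1.integrableOn.sub hfi).const_mul _
        · have := hfg _ (hTX t ht x (hSX hx))
          have := ht.1
          simp only [hφ]
          gcongr
    _ = t⁻¹ * ((∫ x in S, g (T t x)) - ∫ x in S, f x) := by
        rw [integral_const_mul, integral_sub (f := fun x => g (T t x)) hi1.integrableOn hfi]
    _ ≤ t⁻¹ * ((∫ x, g (T t x)) - ∫ x in S, f x) := by
        have := ht.1
        gcongr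
        · exact Eventually.of_forall fun x => hg0 (T t x)
        · exact Measure.restrict_le_self
    _ ≤ t⁻¹ * (((1 - t * a)⁻¹ ^ Module.finrank ℝ E * ∫ x in S, f x) - ∫ x in S, f x) := by
        have := ht.1
        rw [hgS, Real.coe_toNNReal _ (by positivity)] at hi2
        gcongr
    _ = _ := by ring

/-- If `f` is concave and `b` is Lipschitz, then `∫ ⟪b, ∇f⟫` over `{f > 0}` is controlled by `∫ f`,
even where `{f > 0}` reaches the boundary of `X`. Write `b / M = (x₀ + b / M - x) + (x - x₀)`: the
first field keeps `X` invariant, and the second one is handled pointwise by concavity. -/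
theorem setIntegral_inner_le_of_lipschitzOnWith (hXo : IsOpen X) (hXb : Bornology.IsBounded X)
    (hf : ConcaveOn ℝ X f) {H : ℝ} (hH : ∀ x ∈ X, f x ≤ H) (hS : S = {x ∈ X | 0 < f x})
    {x₀ : E} {δ : ℝ} (hδ : 0 ≤ δ) (hball : Metric.closedBall x₀ δ ⊆ X) (hf₀ : 0 ≤ f x₀)
    {G : E → E} (hG : ∀ᵐ x, x ∈ S → HasGradientAt f (G x) x) (hGi : IntegrableOn G S)
    {b : E → E} {L : ℝ≥0} (hb : LipschitzOnWith L b X) {M : ℝ} (hM : 0 < M)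
    (hbM : ∀ x ∈ X, ‖b x‖ ≤ M * δ) :
    ∫ x in S, inner ℝ (G x) (b x) ≤
      M * (Module.finrank ℝ E * (1 + lipschitzExtensionConstant E * L / M) + 1) *
        ∫ x in S, f x := by
  obtain ⟨b', hb', hbb'⟩ := hb.extend_finite_dimension
  have hSX : S ⊆ X := by rw [hS]; exact fun x hx => hx.1
  have hSo : IsOpen S := by
    have := (hf.continuousOn hXo).isOpen_inter_preimage hXo (isOpen_Ioi (a := (0 : ℝ)))
    rw [hS]; exact this
  have hSm := hSo.measurableSet
  have hM' : (M.toNNReal : ℝ) = M := Real.coe_toNNReal _ hM.le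
  have he : LipschitzWith (lipschitzExtensionConstant E * L / M.toNNReal) (fun x => M⁻¹ • b' x) := by
    refine LipschitzWith.of_dist_le_mul fun x y => ?_
    rw [dist_eq_norm, ← smul_sub, norm_smul, norm_inv, Real.norm_eq_abs, abs_of_pos hM,
      ← dist_eq_norm]
    have := hb'.dist_le_mul x y
    rw [inv_mul_le_iff₀ hM]
    refine this.trans (le_of_eq ?_)
    rw [NNReal.coe_div, hM', NNReal.coe_mul]
    field_simp
  have heδ : ∀ x ∈ X, ‖M⁻¹ • b' x‖ ≤ δ := fun x hx => by
    rw [norm_smul, norm_inv, Real.norm_eq_abs, abs_of_pos hM, inv_mul_le_iff₀ hM, ← hbb' hx]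
    exact hbM x hx
  obtain ⟨hfi, h1⟩ := setIntegral_inner_flow_le hXo hXb hf hH hS hball hG hGi he heδ
  have hx₀ : x₀ ∈ X := hball (Metric.mem_closedBall_self hδ)
  obtain ⟨D, hD⟩ := Metric.isBounded_iff.1 hXb
  have hint : ∀ v : E → E, Continuous v → (∃ C, ∀ x ∈ S, ‖v x‖ ≤ C) →
      IntegrableOn (fun x => inner ℝ (G x) (v x)) S := by
    rintro v hv ⟨C, hC⟩
    refine Integrable.mono' (hGi.norm.mul_const C)
      (hGi.aestronglyMeasurable.inner hv.aestronglyMeasurable) ?_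
    filter_upwards [ae_restrict_mem hSm] with x hx
    exact (norm_inner_le_norm _ _).trans (by gcongr; exact hC x hx)
  have hi2 : IntegrableOn (fun x => inner ℝ (G x) (x - x₀)) S :=
    hint _ (by fun_prop) ⟨D, fun x hx => by simpa [dist_eq_norm] using hD (hSX hx) hx₀⟩
  have hi1 : IntegrableOn (fun x => inner ℝ (G x) (x₀ + M⁻¹ • b' x - x)) S := by
    refine hint _ (by have := hb'.continuous; fun_prop) ⟨δ + D, fun x hx => ?_⟩
    have e1 : x₀ + M⁻¹ • b' x - x = M⁻¹ • b' x + (x₀ - x) := by abel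
    rw [e1]
    refine (norm_add_le _ _).trans (add_le_add (heδ x (hSX hx)) ?_)
    simpa [dist_eq_norm] using hD hx₀ (hSX hx)
  have h2 : ∫ x in S, inner ℝ (G x) (x - x₀) ≤ ∫ x in S, f x := by
    refine setIntegral_mono_on_ae hi2 hfi hSm ?_
    filter_upwards [hG] with x hGx hx
    have := le_add_inner_of_hasGradientAt hf (hSX hx) hx₀ (hGx hx)
    rw [← neg_sub x x₀, inner_neg_right] at this
    linarith
  have h3 : ∫ x in S, inner ℝ (G x) (b x) =
      M * ((∫ x in S, inner ℝ (G x) (x₀ + M⁻¹ • b' x - x)) +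
        ∫ x in S, inner ℝ (G x) (x - x₀)) := by
    rw [← integral_add hi1 hi2, ← integral_const_mul]
    refine setIntegral_congr_fun hSm fun x hx => ?_
    rw [← inner_add_right, hbb' (hSX hx), ← inner_smul_right]
    congr 1
    have : x₀ + M⁻¹ • b' x - x + (x - x₀) = M⁻¹ • b' x := by abel
    rw [this, smul_inv_smul₀ hM.ne']
  have hK : ((lipschitzExtensionConstant E * L / M.toNNReal : ℝ≥0) : ℝ) =
      lipschitzExtensionConstant E * L / M := by
    rw [NNReal.coe_div, hM', NNReal.coe_mul]
  rw [hK] at h1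
  rw [h3, mul_assoc]
  gcongr
  linarith

end

/-! ### A lower bound for the mean gradient of a concave function -/

section

variable {E : Type*} [NormedAddCommGroup E] [InnerProductSpace ℝ E] [FiniteDimensional ℝ E]
  [MeasurableSpace E] [BorelSpace E]

/-- The homothetic copy of `S` with centre `x₀` and ratio `1 / 2` has `2⁻ⁿ` times the volume. -/
theorem volume_real_preimage_homothety (S : Set E) (x₀ : E) :
    volume.real ((fun x : E => (2 : ℝ) • x - x₀) ⁻¹' S) =
      (2⁻¹ : ℝ) ^ Module.finrank ℝ E * volume.real S := by
  have : (fun x : E => (2 : ℝ) • x - x₀) ⁻¹' S =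
      (fun x : E => (2 : ℝ) • x) ⁻¹' ((fun x => x + -x₀) ⁻¹' S) := by
    ext x; simp [sub_eq_add_neg]
  rw [measureReal_def, this, Measure.addHaar_preimage_smul _ two_ne_zero, measure_preimage_add_right,
    ENNReal.toReal_mul, ENNReal.toReal_ofReal (abs_nonneg _), abs_of_nonneg (by positivity),
    ← inv_pow, measureReal_def]

variable [CompleteSpace E] {X S : Set E} {f : E → ℝ}

/-- If the convex set `S = {f > 0}` lies in a slab of width `2 r`, then the mean of `|∇f|` over `S`
is at least a multiple of `c / r` if `c ≤ f x₀`. On the half-size copy of `S` about `x₀` one has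
`f ≥ c / 2`, and moving by `2 r` across the slab one leaves `S` without leaving `X`. -/
theorem mul_volume_le_integral_norm_gradient (hXo : IsOpen X) (hXb : Bornology.IsBounded X)
    (hf : ConcaveOn ℝ X f) (hS : S = {x ∈ X | 0 < f x})
    {x₀ e : E} (he : ‖e‖ = 1) {r δ c : ℝ} (hr : 0 < r) (hrδ : 6 * r ≤ δ) (hc : 0 ≤ c)
    (hball : Metric.closedBall x₀ δ ⊆ X) (hf₀ : c ≤ f x₀)
    (hslab : ∀ x ∈ S, |inner ℝ e (x - x₀)| < r)
    {G : E → E} (hG : ∀ᵐ x, x ∈ S → HasGradientAt f (G x) x) (hGi : IntegrableOn G S) :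
    c / (4 * r) * ((2⁻¹ : ℝ) ^ Module.finrank ℝ E * volume.real S) ≤ ∫ x in S, ‖G x‖ := by
  have hδ : 0 ≤ δ := by linarith
  have hSX : S ⊆ X := by rw [hS]; exact fun x hx => hx.1
  have hfc : ContinuousOn f X := hf.continuousOn hXo
  have hSo : IsOpen S := by
    have := hfc.isOpen_inter_preimage hXo (isOpen_Ioi (a := (0 : ℝ)))
    rw [hS]; exact this
  have hSm := hSo.measurableSet
  have hfS : ∀ x ∈ S, 0 < f x := by rw [hS]; exact fun x hx => hx.2
  -- the factor `2` is lost on passing to midpoints of points of the ball and of `S`, in `hmid`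
  obtain ⟨B, hB⟩ : ∃ B : ℝ, ∀ y ∈ Metric.closedBall x₀ δ, -(2 * B) ≤ f y := by
    obtain ⟨m, hm⟩ := ((isCompact_closedBall x₀ δ).image_of_continuousOn
      (hfc.mono hball)).bddBelow
    refine ⟨|m| / 2, fun y hy => ?_⟩
    have := hm (mem_image_of_mem f hy)
    have := neg_abs_le m
    linarith
  set S' : Set E := (fun x : E => (2 : ℝ) • x - x₀) ⁻¹' S with hS'
  have hS'm : MeasurableSet S' :=
    (hSo.preimage (by fun_prop : Continuous fun x : E => (2 : ℝ) • x - x₀)).measurableSet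
  have hvol := volume_real_preimage_homothety S x₀
  rw [← hS'] at hvol
  have hSfin : volume S < ⊤ := (hXb.subset hSX).measure_lt_top
  have hmid : ∀ x ∈ S', ∀ t ∈ Icc (0 : ℝ) (3 * r),
      x + t • e ∈ X ∧ 2⁻¹ * f ((2 : ℝ) • x - x₀) + 2⁻¹ * f (x₀ + (2 * t) • e) ≤ f (x + t • e) ∧
        x₀ + (2 * t) • e ∈ Metric.closedBall x₀ δ := by
    intro x hx t ht
    have hb : x₀ + (2 * t) • e ∈ Metric.closedBall x₀ δ := by
      rw [Metric.mem_closedBall, dist_eq_norm, add_sub_cancel_left, norm_smul, he, mul_one,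
        Real.norm_eq_abs, abs_of_nonneg (by linarith [ht.1])]
      linarith [ht.2]
    have e1 : (2⁻¹ : ℝ) • ((2 : ℝ) • x - x₀) + (2⁻¹ : ℝ) • (x₀ + (2 * t) • e) = x + t • e := by
      module
    have h2 := hf.1 (hSX hx) (hball hb) (by norm_num : (0 : ℝ) ≤ 2⁻¹)
      (by norm_num : (0 : ℝ) ≤ 2⁻¹) (by norm_num)
    have h3 := hf.2 (hSX hx) (hball hb) (by norm_num : (0 : ℝ) ≤ 2⁻¹)
      (by norm_num : (0 : ℝ) ≤ 2⁻¹) (by norm_num)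
    rw [e1] at h2 h3
    exact ⟨h2, h3, hb⟩
  have hfS' : ∀ x ∈ S', x ∈ X ∧ c / 2 ≤ f x := fun x hx => by
    obtain ⟨h1, h2, -⟩ := hmid x hx 0 ⟨le_rfl, by positivity⟩
    have := hfS _ hx
    simp only [zero_smul, add_zero, mul_zero] at h1 h2
    exact ⟨h1, by linarith⟩
  have hfS'pos : ∀ x ∈ S', x ∈ S := fun x hx => by
    obtain ⟨h1, h2, -⟩ := hmid x hx 0 ⟨le_rfl, by positivity⟩
    have := hfS _ hx
    simp only [zero_smul, add_zero, mul_zero] at h1 h2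
    rw [hS]
    exact ⟨h1, by linarith⟩
  have hS'fin : volume S' < ⊤ := (measure_mono fun x hx => hfS'pos x hx).trans_lt hSfin
  -- points of `S'` lie within `r / 2` of the central hyperplane of the slab
  have hend : ∀ x ∈ S', x + (2 * r) • e ∉ S := fun x hx hxS => by
    have h1 := (abs_lt.1 (hslab _ hx)).1
    have h2 := (abs_lt.1 (hslab _ hxS)).2
    have e1 : (2 : ℝ) • x - x₀ - x₀ = (2 : ℝ) • (x - x₀) := by module
    have e2 : x + (2 * r) • e - x₀ = (x - x₀) + (2 * r) • e := by abel
    rw [e1, inner_smul_right] at h1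
    rw [e2, inner_add_right, inner_smul_right, real_inner_self_eq_norm_sq, he] at h2
    linarith
  set A : E → ℝ := S.indicator (fun z => ‖G z‖) with hA
  have hAi : Integrable A := (integrable_indicator_iff hSm).2 hGi.norm
  have hA0 : 0 ≤ A := fun z => indicator_nonneg (fun _ _ => norm_nonneg _) z
  have hAint : ∫ x, A x = ∫ x in S, ‖G x‖ := integral_indicator hSm
  have hstep : ∀ N : ℕ, 0 < N → c / 2 * volume.real S' ≤
      2 * r * (∫ x in S, ‖G x‖) + (2 * r / N) * (B / r * volume.real S') := by
    intro N hN
    have hN' : (0 : ℝ) < N := by exact_mod_cast hN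
    set v : ℕ → E := fun k => (k * (2 * r / N)) • e with hv
    have hae : ∀ᵐ x, ∀ k : ℕ, x + v k ∈ S → HasGradientAt f (G (x + v k)) (x + v k) := by
      rw [ae_all_iff]
      exact fun k => (measurePreserving_add_right volume (v k)).quasiMeasurePreserving.ae hG
    have hAv : ∀ k, Integrable (fun x => A (x + v k)) := fun k => hAi.comp_add_right (v k)
    have hsum : Integrable (fun x => ∑ k ∈ Finset.range N, A (x + v (k + 1))) :=
      integrable_finsetSum _ fun k _ => hAv (k + 1)
    have hconst : ∀ a : ℝ, IntegrableOn (fun _ : E => a) S' := fun a =>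
      integrableOn_const hS'fin.ne
    have h1 : ∫ _x in S', c / 2 ≤ ∫ x in S',
        ((2 * r / N) * (∑ k ∈ Finset.range N, A (x + v (k + 1))) + (2 * r / N) * (B / r)) := by
      refine setIntegral_mono_on_ae (hconst _) ((hsum.integrableOn.const_mul _).add (hconst _))
        hS'm ?_
      filter_upwards [hae] with x hx hxS'
      refine (hfS' x hxS').2.trans ?_
      refine le_sum_indicator_norm_gradient hf hS he hr hN (fun t ht => (hmid x hxS' t ht).1)
        (fun t ht => ?_) (hfS'pos x hxS') (hend x hxS') hx
      obtain ⟨-, h2, h3⟩ := hmid x hxS' t ht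
      have := hB _ h3
      have := hfS _ hxS'
      linarith
    rw [integral_add (hsum.integrableOn.const_mul _) (hconst _), integral_const_mul,
      setIntegral_const, setIntegral_const, smul_eq_mul, smul_eq_mul,
      integral_finsetSum _ fun k _ => (hAv (k + 1)).integrableOn] at h1
    have h2 : ∀ k ∈ Finset.range N, ∫ x in S', A (x + v (k + 1)) ≤ ∫ x in S, ‖G x‖ := by
      intro k _
      refine (setIntegral_le_integral (hAv _)
        (Eventually.of_forall fun x => hA0 (x + v (k + 1)))).trans ?_
      rw [integral_add_right_eq_self A (v (k + 1)), hAint]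
    have h3 := Finset.sum_le_sum h2
    rw [Finset.sum_const, Finset.card_range, nsmul_eq_mul] at h3
    have h4 : 2 * r / N * ∑ k ∈ Finset.range N, ∫ x in S', A (x + v (k + 1)) ≤
        2 * r / N * (N * ∫ x in S, ‖G x‖) := by gcongr
    have h5 : 2 * r / N * (N * ∫ x in S, ‖G x‖) = 2 * r * ∫ x in S, ‖G x‖ := by field_simp
    linarith
  -- the error made where the lines leave `S` vanishes as the step size tends to `0`
  have hlim : Tendsto (fun N : ℕ => 2 * r * (∫ x in S, ‖G x‖) +
      (2 * r / N) * (B / r * volume.real S')) atTop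
      (𝓝 (2 * r * (∫ x in S, ‖G x‖) + 0 * (B / r * volume.real S'))) :=
    ((tendsto_const_div_atTop_nhds_zero_nat _).mul_const _).const_add _
  have hfinal : c / 2 * volume.real S' ≤ _ := ge_of_tendsto hlim
    (by filter_upwards [eventually_gt_atTop 0] with N hN using hstep N hN)
  rw [← hvol, div_mul_eq_mul_div, div_le_iff₀ (by positivity)]
  linarith

end

/-! ### Uniform convexity of the power of the norm -/

section

variable {E : Type*} [NormedAddCommGroup E] [InnerProductSpace ℝ E]

/-- The tangent inequality for `‖·‖ ^ q / q`, whose gradient at `p` is `‖p‖ ^ (q - 2) • p`. -/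
theorem norm_rpow_div_tangent_le {q : ℝ} (hq : 1 < q) (p ξ : E) :
    ‖p‖ ^ q / q + inner ℝ (‖p‖ ^ (q - 2) • p) (ξ - p) ≤ ‖ξ‖ ^ q / q := by
  have hq0 : 0 < q := by linarith
  rcases eq_or_ne p 0 with rfl | hp
  · simp only [norm_zero, smul_zero, inner_zero_left, add_zero]
    rw [Real.zero_rpow hq0.ne']
    simp only [zero_div]
    positivity
  have ha : 0 < ‖p‖ := norm_pos_iff.2 hp
  have h1 : ‖p‖ ^ (q - 2) * ‖p‖ = ‖p‖ ^ (q - 1) := by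
    rw [← Real.rpow_add_one ha.ne']; congr 1; ring
  have h2 : ‖p‖ ^ (q - 1) * ‖p‖ = ‖p‖ ^ q := by
    rw [← Real.rpow_add_one ha.ne']; congr 1; ring
  have hconj : q.HolderConjugate (q / (q - 1)) := Real.HolderConjugate.conjExponent hq
  -- after Cauchy's inequality for `⟪p, ξ⟫`, the claim is Young's inequality for `‖ξ‖ ‖p‖ ^ (q - 1)`
  have hy := Real.young_inequality_of_nonneg (norm_nonneg ξ)
    (Real.rpow_nonneg (norm_nonneg p) (q - 1)) hconj
  rw [← Real.rpow_mul (norm_nonneg p)] at hy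
  have h3 : (q - 1) * (q / (q - 1)) = q := by
    have : q - 1 ≠ 0 := by linarith
    field_simp
  rw [h3] at hy
  have h4 : ‖p‖ ^ q / (q / (q - 1)) = ‖p‖ ^ q - ‖p‖ ^ q / q := by
    field_simp
  have h5 : inner ℝ p ξ ≤ ‖p‖ * ‖ξ‖ := real_inner_le_norm _ _
  have h6 : ‖p‖ ^ (q - 2) * inner ℝ p ξ ≤ ‖p‖ ^ (q - 1) * ‖ξ‖ := by
    rw [← h1, mul_assoc]; gcongr
  have h7 : ‖p‖ ^ (q - 2) * (‖p‖ * ‖p‖) = ‖p‖ ^ q := by rw [← mul_assoc, h1, h2]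
  rw [inner_smul_left, inner_sub_right, real_inner_self_eq_norm_mul_norm]
  simp only [conj_trivial, mul_sub]
  rw [h7]
  linarith

/-- For `q ≥ 2`, the gain in midpoint convexity of `‖·‖ ^ q / q` (Clarkson's inequality). -/
theorem midpoint_norm_rpow_of_two_le {q : ℝ} (hq : 2 ≤ q) (x y : E) :
    ‖(2⁻¹ : ℝ) • (x + y)‖ ^ q / q + (2⁻¹ ^ q / q) * ‖x - y‖ ^ q ≤
      2⁻¹ * (‖x‖ ^ q / q) + 2⁻¹ * (‖y‖ ^ q / q) := by
  have hq0 : 0 < q := by linarith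
  have hq2 : 1 ≤ q / 2 := by linarith
  have hsq : ∀ z : E, ‖z‖ ^ q = (‖z‖ ^ 2) ^ (q / 2) := fun z => by
    rw [← Real.rpow_natCast, ← Real.rpow_mul (norm_nonneg z)]
    congr 1; push_cast; ring
  have h1 := Real.add_rpow_le_rpow_add (sq_nonneg ‖(2⁻¹ : ℝ) • (x + y)‖)
    (sq_nonneg ‖(2⁻¹ : ℝ) • (x - y)‖) hq2
  have h2 : ‖(2⁻¹ : ℝ) • (x + y)‖ ^ 2 + ‖(2⁻¹ : ℝ) • (x - y)‖ ^ 2 =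
      2⁻¹ * ‖x‖ ^ 2 + 2⁻¹ * ‖y‖ ^ 2 := by
    have := parallelogram_law_with_norm ℝ x y
    rw [norm_smul, norm_smul, mul_pow, mul_pow, Real.norm_eq_abs, abs_of_pos (by norm_num)]
    linarith
  have h3 := (convexOn_rpow hq2).2 (mem_Ici.2 (sq_nonneg ‖x‖)) (mem_Ici.2 (sq_nonneg ‖y‖))
    (by norm_num : (0 : ℝ) ≤ 2⁻¹) (by norm_num : (0 : ℝ) ≤ 2⁻¹) (by norm_num)
  simp only [smul_eq_mul] at h3
  rw [h2, ← hsq, ← hsq] at h1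
  rw [← hsq, ← hsq] at h3
  have h4 : ‖(2⁻¹ : ℝ) • (x - y)‖ ^ q = 2⁻¹ ^ q * ‖x - y‖ ^ q := by
    rw [norm_smul, Real.norm_eq_abs, abs_of_pos (by norm_num),
      Real.mul_rpow (by norm_num) (norm_nonneg _)]
  rw [h4] at h1
  have h5 := div_le_div_of_nonneg_right (h1.trans h3) hq0.le
  calc _ = (‖(2⁻¹ : ℝ) • (x + y)‖ ^ q + 2⁻¹ ^ q * ‖x - y‖ ^ q) / q := by ring
    _ ≤ _ := h5
    _ = _ := by ring

/-- For `q ≤ 2`, the function `s ^ q / q` minus a small multiple of `s ^ 2` is still convex and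
monotone on `[0, R]`. -/
theorem convexOn_monotoneOn_rpow_sub_sq {q R : ℝ} (hq : 1 < q) (hq2 : q ≤ 2) (hR : 0 < R) :
    ConvexOn ℝ (Icc 0 R) (fun s : ℝ => s ^ q / q - (q - 1) * R ^ (q - 2) / 2 * s ^ 2) ∧
    MonotoneOn (fun s : ℝ => s ^ q / q - (q - 1) * R ^ (q - 2) / 2 * s ^ 2) (Icc 0 R) := by
  have hq0 : 0 < q := by linarith
  set κ := (q - 1) * R ^ (q - 2) / 2 with hκ
  have hc : ContinuousOn (fun s : ℝ => s ^ q / q - κ * s ^ 2) (Icc 0 R) := by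
    refine ContinuousOn.sub (ContinuousOn.div_const (fun s _ => ?_) q) (by fun_prop)
    exact (Real.continuousAt_rpow_const s q (Or.inr hq0.le)).continuousWithinAt
  have hd : ∀ s ∈ interior (Icc 0 R), HasDerivWithinAt (fun s : ℝ => s ^ q / q - κ * s ^ 2)
      (s ^ (q - 1) - 2 * κ * s) (interior (Icc 0 R)) s := fun s hs => by
    rw [interior_Icc] at hs
    have h1 := (Real.hasDerivAt_rpow_const (x := s) (p := q) (Or.inl hs.1.ne')).div_const q
    have h2 := ((hasDerivAt_id s).fun_pow 2).const_mul κ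
    have h3 := (h1.fun_sub h2).hasDerivWithinAt (s := interior (Icc 0 R))
    refine h3.congr_deriv ?_
    simp only [id]; field_simp; ring
  have hd2 : ∀ s ∈ interior (Icc 0 R), HasDerivWithinAt (fun s : ℝ => s ^ (q - 1) - 2 * κ * s)
      ((q - 1) * s ^ (q - 2) - 2 * κ) (interior (Icc 0 R)) s := fun s hs => by
    rw [interior_Icc] at hs
    have h1 := Real.hasDerivAt_rpow_const (x := s) (p := q - 1) (Or.inl hs.1.ne')
    have h2 := (hasDerivAt_id s).const_mul (2 * κ)
    have h3 := (h1.fun_sub h2).hasDerivWithinAt (s := interior (Icc 0 R))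
    refine h3.congr_deriv ?_
    rw [mul_one, sub_sub]; norm_num
  have hpow : ∀ s ∈ interior (Icc 0 R), R ^ (q - 2) ≤ s ^ (q - 2) := fun s hs => by
    rw [interior_Icc] at hs
    exact Real.rpow_le_rpow_of_nonpos hs.1 hs.2.le (by linarith)
  constructor
  · refine convexOn_of_hasDerivWithinAt2_nonneg (convex_Icc 0 R) hc hd hd2 fun s hs => ?_
    have := mul_le_mul_of_nonneg_left (hpow s hs) (by linarith : 0 ≤ q - 1)
    rw [hκ]; linarith
  · refine monotoneOn_of_hasDerivWithinAt_nonneg (convex_Icc 0 R) hc hd fun s hs => ?_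
    have h1 := hpow s hs
    rw [interior_Icc] at hs
    have h2 : s ^ (q - 1) = s ^ (q - 2) * s := by
      rw [← Real.rpow_add_one hs.1.ne']; congr 1; ring
    have h3 : 0 ≤ R ^ (q - 2) := by positivity
    have h4 : 2 * κ ≤ s ^ (q - 2) := by
      rw [hκ]; nlinarith
    have := hs.1
    rw [h2, ← sub_mul]
    exact mul_nonneg (by linarith) hs.1.le

/-- For `q ≤ 2`, the gain in midpoint convexity of `‖·‖ ^ q / q` on a ball. -/
theorem midpoint_norm_rpow_of_le_two {q R : ℝ} (hq : 1 < q) (hq2 : q ≤ 2) (hR : 0 < R) {x y : E}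
    (hx : ‖x‖ ≤ R) (hy : ‖y‖ ≤ R) :
    ‖(2⁻¹ : ℝ) • (x + y)‖ ^ q / q + ((q - 1) * R ^ (q - 2) / 8) * ‖x - y‖ ^ 2 ≤
      2⁻¹ * (‖x‖ ^ q / q) + 2⁻¹ * (‖y‖ ^ q / q) := by
  obtain ⟨h1, h2⟩ := convexOn_monotoneOn_rpow_sub_sq hq hq2 hR
  have hmid : ‖(2⁻¹ : ℝ) • (x + y)‖ ≤ 2⁻¹ * ‖x‖ + 2⁻¹ * ‖y‖ := by
    rw [norm_smul, Real.norm_eq_abs, abs_of_pos (by norm_num), ← mul_add]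
    gcongr
    exact norm_add_le _ _
  have h3 := h1.2 (⟨norm_nonneg x, hx⟩ : ‖x‖ ∈ Icc 0 R) (⟨norm_nonneg y, hy⟩ : ‖y‖ ∈ Icc 0 R)
    (by norm_num : (0 : ℝ) ≤ 2⁻¹) (by norm_num : (0 : ℝ) ≤ 2⁻¹) (by norm_num)
  have h4 := h2 (⟨norm_nonneg _, hmid.trans (by linarith)⟩ : ‖(2⁻¹ : ℝ) • (x + y)‖ ∈ Icc 0 R)
    (⟨by positivity, by linarith⟩ : 2⁻¹ * ‖x‖ + 2⁻¹ * ‖y‖ ∈ Icc 0 R) hmid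
  simp only [smul_eq_mul] at h3 h4
  have h5 : ‖(2⁻¹ : ℝ) • (x + y)‖ ^ 2 + 4⁻¹ * ‖x - y‖ ^ 2 = 2⁻¹ * ‖x‖ ^ 2 + 2⁻¹ * ‖y‖ ^ 2 := by
    have := parallelogram_law_with_norm ℝ x y
    rw [norm_smul, mul_pow, Real.norm_eq_abs, abs_of_pos (by norm_num)]
    linarith
  have h6 := congrArg (fun z => (q - 1) * R ^ (q - 2) / 2 * z) h5
  linarith

/-- On bounded sets, `‖·‖ ^ q / q` is uniformly convex with power `max q 2`. -/
theorem exists_midpoint_norm_rpow {q R : ℝ} (hq : 1 < q) (hR : 0 < R) :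
    ∃ κ > 0, ∀ x y : E, ‖x‖ ≤ R → ‖y‖ ≤ R →
      ‖(2⁻¹ : ℝ) • (x + y)‖ ^ q / q + κ * ‖x - y‖ ^ (max q 2) ≤
        2⁻¹ * (‖x‖ ^ q / q) + 2⁻¹ * (‖y‖ ^ q / q) := by
  rcases le_total 2 q with h | h
  · rw [max_eq_left h]
    exact ⟨2⁻¹ ^ q / q, by positivity, fun x y _ _ => midpoint_norm_rpow_of_two_le h x y⟩
  · rw [max_eq_right h]
    refine ⟨(q - 1) * R ^ (q - 2) / 8, ?_, fun x y hx hy => ?_⟩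
    · have : 0 < q - 1 := by linarith
      positivity
    · rw [Real.rpow_two]
      exact midpoint_norm_rpow_of_le_two hq h hR hx hy

/-- A lower bound, affine in `‖ξ - p‖`, for the distance of `‖ξ‖ ^ q / q` from its tangent at `p`.
Uniform convexity gives it at distance `s` from `p`, and convexity extends it along rays, so that it
holds for all `ξ` although uniform convexity may only hold locally. -/
theorem exists_norm_rpow_div_ge {q R : ℝ} (hq : 1 < q) (hR : 0 < R) :
    ∃ c > 0, ∀ p ξ : E, ∀ s : ℝ, ‖p‖ ≤ R → 0 < s → s ≤ R →
      ‖p‖ ^ q / q + inner ℝ (‖p‖ ^ (q - 2) • p) (ξ - p) + c * s ^ (max q 2 - 1) * (‖ξ - p‖ - s) ≤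
        ‖ξ‖ ^ q / q := by
  obtain ⟨κ, hκ, hmid⟩ := exists_midpoint_norm_rpow (E := E) hq (by positivity : 0 < 2 * R)
  refine ⟨2 * κ, by positivity, fun p ξ s hp hs hsR => ?_⟩
  set P := ‖p‖ ^ (q - 2) • p with hP
  have hpow : 0 < s ^ (max q 2 - 1) := by positivity
  rcases le_total ‖ξ - p‖ s with h | h
  · have h1 := norm_rpow_div_tangent_le hq p ξ
    have : 2 * κ * s ^ (max q 2 - 1) * (‖ξ - p‖ - s) ≤ 0 :=
      mul_nonpos_of_nonneg_of_nonpos (by positivity) (by linarith)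
    linarith
  set d := ‖ξ - p‖ with hd
  have hd0 : 0 < d := hs.trans_le h
  set θ := s / d with hθ
  have hθ0 : 0 < θ := by positivity
  have hθ1 : θ ≤ 1 := (div_le_one hd0).2 h
  set z := p + θ • (ξ - p) with hz
  have hzp : ‖z - p‖ = s := by
    rw [hz, add_sub_cancel_left, norm_smul, Real.norm_eq_abs, abs_of_pos hθ0, hθ, ← hd]
    field_simp
  have hzR : ‖z‖ ≤ 2 * R := by
    have : z = p + (z - p) := by abel
    rw [this]
    exact (norm_add_le _ _).trans (by linarith)
  have h1 := hmid z p hzR (by linarith)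
  rw [hzp] at h1
  have h2 := norm_rpow_div_tangent_le hq p ((2⁻¹ : ℝ) • (z + p))
  have e1 : (2⁻¹ : ℝ) • (z + p) - p = (2⁻¹ * θ) • (ξ - p) := by rw [hz]; module
  rw [e1, inner_smul_right] at h2
  have h3 := norm_rpow_div_tangent_le hq z p
  have h4 := norm_rpow_div_tangent_le hq z ξ
  have e2 : p - z = (-θ) • (ξ - p) := by rw [hz]; module
  have e3 : ξ - z = (1 - θ) • (ξ - p) := by rw [hz]; module
  rw [e2, inner_smul_right] at h3
  rw [e3, inner_smul_right] at h4
  set I := inner ℝ (‖z‖ ^ (q - 2) • z) (ξ - p) with hI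
  -- convexity along the ray from `p` through `z` to `ξ`
  have h5 : ‖z‖ ^ q / q ≤ (1 - θ) * (‖p‖ ^ q / q) + θ * (‖ξ‖ ^ q / q) := by
    have a := mul_le_mul_of_nonneg_left h3 (by linarith : 0 ≤ 1 - θ)
    have b := mul_le_mul_of_nonneg_left h4 hθ0.le
    nlinarith
  have h6 : θ * (‖p‖ ^ q / q + inner ℝ P (ξ - p)) + 2 * κ * s ^ max q 2 ≤ θ * (‖ξ‖ ^ q / q) := by
    rw [← hP] at h2
    linarith
  have h7 : s ^ max q 2 = θ * (s ^ (max q 2 - 1) * d) := by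
    have : s ^ max q 2 = s ^ (max q 2 - 1) * s := by
      rw [← Real.rpow_add_one hs.ne']; congr 1; ring
    rw [this, hθ]; field_simp
  rw [h7] at h6
  have h8 : θ * (‖p‖ ^ q / q + inner ℝ P (ξ - p) + 2 * κ * s ^ (max q 2 - 1) * d) ≤
      θ * (‖ξ‖ ^ q / q) := by linarith
  have h9 := le_of_mul_le_mul_left h8 hθ0
  have : 0 ≤ 2 * κ * s ^ (max q 2 - 1) * s := by positivity
  linarith

end

/-! ### Comparison with the maximum of a minimizer and an affine function -/

section

variable {n : ℕ} {X : Set (EuclideanSpace ℝ (Fin n))} {q : ℝ}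
  {γ u : EuclideanSpace ℝ (Fin n) → ℝ}

theorem measurable_gradient (u : EuclideanSpace ℝ (Fin n) → ℝ) : Measurable (gradient u) :=
  (InnerProductSpace.toDual ℝ _).symm.continuous.measurable.comp (measurable_fderiv ℝ u)

theorem hasGradientAt_const_add_inner {E : Type*} [NormedAddCommGroup E] [InnerProductSpace ℝ E]
    [CompleteSpace E] (c : ℝ) (p x : E) : HasGradientAt (fun y => c + inner ℝ p y) p x := by
  rw [hasGradientAt_iff_hasFDerivAt]
  exact ((InnerProductSpace.toDual ℝ E p).hasFDerivAt).const_add c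

theorem concaveOn_const_add_inner_sub {E : Type*} [NormedAddCommGroup E] [InnerProductSpace ℝ E]
    {X : Set E} {u : E → ℝ} (hu : ConvexOn ℝ X u) (c : ℝ) (p : E) :
    ConcaveOn ℝ X (fun x => c + inner ℝ p x - u x) := by
  refine ConcaveOn.sub ⟨hu.1, fun x _ y _ a b _ _ hab => le_of_eq ?_⟩ hu
  simp only [inner_add_right, inner_smul_right, smul_eq_mul]
  linear_combination c * hab

theorem ae_hasGradientAt_const_add_inner_sub (hXo : IsOpen X) (hu : ConvexOn ℝ X u) (c : ℝ)
    (p : EuclideanSpace ℝ (Fin n)) :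
    ∀ᵐ x, x ∈ X → HasGradientAt (fun x => c + inner ℝ p x - u x) (p - gradient u x) x := by
  filter_upwards [ae_differentiableAt hXo hu] with x hx hxX
  have h1 := (hasGradientAt_const_add_inner c p x).hasFDerivAt
  have h2 := (hx hxX).hasGradientAt.hasFDerivAt
  rw [hasGradientAt_iff_hasFDerivAt, map_sub]
  exact h1.sub h2

/-- The boundary points of `{u < ℓ}` inside `X` form a null set, because `{u < ℓ}` is convex. The
set `{u = ℓ}` consists of such points: a segment towards a point of `{u < ℓ}` lies in `{u < ℓ}`. -/
theorem ae_lt_of_notMem_sublevel (hXo : IsOpen X) (hu : ConvexOn ℝ X u)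
    {ℓ : EuclideanSpace ℝ (Fin n) → ℝ} (hℓ : ConcaveOn ℝ X ℓ)
    {z : EuclideanSpace ℝ (Fin n)} (hz : z ∈ X) (hzℓ : u z < ℓ z) :
    ∀ᵐ x, x ∈ X → ¬ u x < ℓ x → ℓ x < u x := by
  set S := {x ∈ X | u x - ℓ x < 0} with hS
  have hconv : ConvexOn ℝ X (fun x => u x - ℓ x) := hu.sub hℓ
  have hSc : Convex ℝ S := hconv.convex_lt 0
  have hSo : IsOpen S :=
    (hconv.continuousOn hXo).isOpen_inter_preimage hXo (isOpen_Iio (a := (0 : ℝ)))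
  have h0 : volume (frontier S) = 0 := hSc.addHaar_frontier volume
  filter_upwards [compl_mem_ae_iff.2 h0] with x hx hxX hxℓ
  rcases (not_lt.1 hxℓ).lt_or_eq with h | h
  · exact h
  refine absurd ?_ hx
  rw [frontier, hSo.interior_eq]
  refine ⟨?_, fun hxS => hxℓ (by linarith [hxS.2])⟩
  have hlim : Tendsto (fun t : ℝ => x + t • (z - x)) (𝓝[>] 0) (𝓝 (x + (0 : ℝ) • (z - x))) :=
    ((by fun_prop : Continuous fun t : ℝ => x + t • (z - x)).tendsto 0).mono_left
      nhdsWithin_le_nhds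
  rw [zero_smul, add_zero] at hlim
  refine mem_closure_of_tendsto hlim ?_
  filter_upwards [Ioo_mem_nhdsGT (one_pos : (0 : ℝ) < 1)] with t ht
  have e1 : (1 - t) • x + t • z = x + t • (z - x) := by module
  have h1 := hconv.1 hxX hz (by linarith [ht.2] : (0 : ℝ) ≤ 1 - t) ht.1.le (by ring)
  have h2 := hconv.2 hxX hz (by linarith [ht.2] : (0 : ℝ) ≤ 1 - t) ht.1.le (by ring)
  rw [e1] at h1 h2
  refine ⟨h1, h2.trans_lt ?_⟩
  simp only [smul_eq_mul, h, sub_self, mul_zero, zero_add]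
  exact mul_neg_of_pos_of_neg ht.1 (by linarith)

/-- Comparison of a minimizer `u` with the admissible function `max u ℓ`, for `ℓ` affine. -/
theorem IsMinimizer.setIntegral_integrand_le {a₀ : ℝ} {y₀ : EuclideanSpace ℝ (Fin n)}
    (hu : IsMinimizer q γ X a₀ y₀ u) (hXo : IsOpen X) (hXb : Bornology.IsBounded X)
    (hγc : ContinuousOn γ X) {Γ : ℝ} (hΓ : ∀ x ∈ X, |γ x| ≤ Γ)
    (c : ℝ) (p : EuclideanSpace ℝ (Fin n)) {S : Set (EuclideanSpace ℝ (Fin n))}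
    (hS : S = {x ∈ X | 0 < c + inner ℝ p x - u x}) (hSne : S.Nonempty) :
    IntegrableOn (fun x => (‖p‖ ^ q / q - inner ℝ x p + (c + inner ℝ p x)) * γ x) S ∧
    ∫ x in S, integrand q γ u x ≤
      ∫ x in S, (‖p‖ ^ q / q - inner ℝ x p + (c + inner ℝ p x)) * γ x := by
  obtain ⟨⟨huc, hu0⟩, hui, hule⟩ := hu
  set ℓ : EuclideanSpace ℝ (Fin n) → ℝ := fun x => c + inner ℝ p x with hℓ
  have hℓlin : ∀ (x y : EuclideanSpace ℝ (Fin n)) (a b : ℝ), a + b = 1 →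
      ℓ (a • x + b • y) = a * ℓ x + b * ℓ y := fun x y a b hab => by
    simp only [hℓ, inner_add_right, inner_smul_right]
    linear_combination (-c) * hab
  have hℓconv : ConvexOn ℝ X ℓ :=
    ⟨huc.1, fun x _ y _ a b _ _ hab => (hℓlin x y a b hab).le⟩
  have hℓconc : ConcaveOn ℝ X ℓ :=
    ⟨huc.1, fun x _ y _ a b _ _ hab => (hℓlin x y a b hab).ge⟩
  have hSX : S ⊆ X := by rw [hS]; exact fun x hx => hx.1
  have hSℓ : ∀ x ∈ S, u x < ℓ x := by rw [hS]; exact fun x hx => by linarith [hx.2]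
  have hSo : IsOpen S := by
    have := ((hℓconc.sub huc).continuousOn hXo).isOpen_inter_preimage hXo
      (isOpen_Ioi (a := (0 : ℝ)))
    rw [hS]; exact this
  have hSm := hSo.measurableSet
  set v : EuclideanSpace ℝ (Fin n) → ℝ := fun x => max (u x) (ℓ x) with hv
  have hvadm : v ∈ Admissible X a₀ y₀ :=
    ⟨huc.sup hℓconv, fun x hx => (hu0 x hx).trans (le_max_left _ _)⟩
  set k : EuclideanSpace ℝ (Fin n) → ℝ :=
    fun x => (‖p‖ ^ q / q - inner ℝ x p + (c + inner ℝ p x)) * γ x with hk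
  have hvS : ∀ x ∈ S, integrand q γ v x = k x := fun x hx => by
    have h1 : v =ᶠ[𝓝 x] ℓ := by
      filter_upwards [hSo.mem_nhds hx] with y hy using max_eq_right (hSℓ y hy).le
    simp only [integrand, hk]
    rw [h1.gradient_eq, (hasGradientAt_const_add_inner c p x).gradient, h1.eq_of_nhds]
  have hvX : ∀ᵐ x, x ∈ X \ S → integrand q γ v x = integrand q γ u x := by
    obtain ⟨z, hz⟩ := hSne
    filter_upwards [ae_lt_of_notMem_sublevel hXo huc hℓconc (hSX hz) (hSℓ z hz)] with x hx hxS
    have h0 : ℓ x < u x := hx hxS.1 fun h => hxS.2 (by rw [hS]; exact ⟨hxS.1, by linarith⟩)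
    have h1 : v =ᶠ[𝓝 x] u := by
      have hcont := ((hℓconc.sub huc).continuousOn hXo).continuousAt (hXo.mem_nhds hxS.1)
      filter_upwards [hcont.eventually_lt_const (show (ℓ - u) x < 0 by simpa using h0)] with y hy
      exact max_eq_left (by simpa using hy.le)
    simp only [integrand]
    rw [h1.gradient_eq, h1.eq_of_nhds]
  obtain ⟨R, hR⟩ := hXb.exists_norm_le
  have hSfin : volume S < ⊤ := (hXb.subset hSX).measure_lt_top
  have hki : IntegrableOn k S := by
    have hkc : ContinuousOn k S := by
      have := hγc.mono hSX
      fun_prop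
    refine IntegrableOn.of_bound hSfin (hkc.aestronglyMeasurable hSm)
      ((|‖p‖ ^ q / q| + R * ‖p‖ + (|c| + ‖p‖ * R)) * Γ) ?_
    filter_upwards [ae_restrict_mem hSm] with x hx
    have h1 := hΓ x (hSX hx)
    have h2 := hR x (hSX hx)
    have h3 : |inner ℝ x p| ≤ R * ‖p‖ := (abs_real_inner_le_norm _ _).trans (by gcongr)
    have h4 : |inner ℝ p x| ≤ ‖p‖ * R := (abs_real_inner_le_norm _ _).trans (by gcongr)
    have h5 : |‖p‖ ^ q / q - inner ℝ x p + (c + inner ℝ p x)| ≤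
        |‖p‖ ^ q / q| + R * ‖p‖ + (|c| + ‖p‖ * R) :=
      (abs_add_le _ _).trans (add_le_add ((abs_sub _ _).trans (by linarith))
        ((abs_add_le _ _).trans (by linarith)))
    rw [Real.norm_eq_abs, abs_mul]
    exact mul_le_mul h5 h1 (abs_nonneg _) ((abs_nonneg _).trans h5)
  have hdiffm : MeasurableSet (X \ S) := hXo.measurableSet.diff hSm
  have hviS : IntegrableOn (integrand q γ v) S :=
    hki.congr_fun (fun x hx => (hvS x hx).symm) hSm
  have huiD : IntegrableOn (integrand q γ u) (X \ S) := hui.mono_set sdiff_subset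
  have hviD : IntegrableOn (integrand q γ v) (X \ S) := by
    refine huiD.congr ?_
    filter_upwards [ae_restrict_mem hdiffm, ae_restrict_of_ae hvX] with x hx h using (h hx).symm
  have hXS : S ∪ X \ S = X := union_sdiff_cancel hSX
  have hvi : IntegrableOn (integrand q γ v) X := by
    rw [← hXS]; exact hviS.union hviD
  refine ⟨hki, ?_⟩
  have hmin := hule v hvadm hvi
  have hsplit : ∀ w, IntegrableOn (integrand q γ w) S → IntegrableOn (integrand q γ w) (X \ S) →
      energy q γ X w = (∫ x in S, integrand q γ w x) + ∫ x in X \ S, integrand q γ w x := by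
    intro w h1 h2
    rw [energy, ← setIntegral_union disjoint_sdiff_right hdiffm h1 h2, hXS]
  rw [hsplit u (hui.mono_set hSX) huiD, hsplit v hviS hviD, setIntegral_congr_ae hdiffm hvX,
    setIntegral_congr_fun hSm hvS] at hmin
  linarith

/-- Finite energy bounds the gradient in `L¹` on sets where `u` is bounded: for `q > 1`, Young's
inequality absorbs the linear term of the integrand. -/
theorem integrableOn_gradient (hq : 1 < q) (hXb : Bornology.IsBounded X)
    {lam : ℝ} (hlam : 0 < lam) (hγ : ∀ x ∈ X, lam ≤ γ x)
    (hui : IntegrableOn (integrand q γ u) X) {S : Set (EuclideanSpace ℝ (Fin n))}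
    (hSm : MeasurableSet S) (hSX : S ⊆ X) {B : ℝ} (hB : ∀ x ∈ S, |u x| ≤ B) :
    IntegrableOn (gradient u) S := by
  obtain ⟨R, hR⟩ := hXb.exists_norm_le
  have hq0 : 0 < q := by linarith
  have hSfin : volume S < ⊤ := (hXb.subset hSX).measure_lt_top
  have hconj : q.HolderConjugate (q / (q - 1)) := Real.HolderConjugate.conjExponent hq
  set R' := |R| + 1 with hR'
  set D := R' ^ (q / (q - 1)) / (q / (q - 1)) with hD
  have hdom : IntegrableOn (fun x => lam⁻¹ * ‖integrand q γ u x‖ + (B + D)) S := by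
    have h1 : IntegrableOn (fun x => lam⁻¹ * ‖integrand q γ u x‖) S :=
      (hui.mono_set hSX).norm.const_mul _
    exact h1.add (integrableOn_const hSfin.ne)
  refine Integrable.mono' hdom (measurable_gradient u).aestronglyMeasurable ?_
  filter_upwards [ae_restrict_mem hSm] with x hx
  set ξ := gradient u x with hξ
  have hγx := hγ x (hSX hx)
  have h1 := Real.young_inequality_of_nonneg (norm_nonneg ξ) (by positivity : 0 ≤ R') hconj
  rw [← hD] at h1
  have h2 : inner ℝ x ξ ≤ |R| * ‖ξ‖ := (real_inner_le_norm _ _).trans (by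
    gcongr; exact (hR x (hSX hx)).trans (le_abs_self R))
  have h3 := (abs_le.1 (hB x hx)).1
  set A := ‖ξ‖ ^ q / q - inner ℝ x ξ + u x with hA
  have h4 : ‖ξ‖ ≤ A + (B + D) := by
    rw [hR'] at h1; rw [hA]; linarith
  have h5 : A ≤ lam⁻¹ * ‖integrand q γ u x‖ := by
    have h6 : ‖integrand q γ u x‖ = |A| * γ x := by
      rw [integrand, Real.norm_eq_abs, abs_mul, abs_of_pos (hlam.trans_le hγx)]
    rw [h6, inv_mul_eq_div, le_div_iff₀ hlam]
    calc A * lam ≤ |A| * lam := by gcongr; exact le_abs_self A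
      _ ≤ |A| * γ x := by gcongr
  linarith

end

/-! ### The excess inequality -/

section

variable {n : ℕ} {X : Set (EuclideanSpace ℝ (Fin n))} {q : ℝ}
  {γ u : EuclideanSpace ℝ (Fin n) → ℝ}

/-- The product of a bounded Lipschitz function with `P - x` is Lipschitz. -/
theorem lipschitzOnWith_smul_sub {Mγ Q : ℝ≥0} (hγl : LipschitzOnWith Mγ γ X) {Γ : ℝ}
    (hΓ : ∀ x ∈ X, |γ x| ≤ Γ) (P : EuclideanSpace ℝ (Fin n)) (hP : ∀ x ∈ X, ‖P - x‖ ≤ Q) :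
    LipschitzOnWith (Mγ * Q + Γ.toNNReal) (fun x => γ x • (P - x)) X := by
  refine LipschitzOnWith.of_dist_le_mul fun x hx y hy => ?_
  have e1 : γ x • (P - x) - γ y • (P - y) = (γ x - γ y) • (P - x) + γ y • (y - x) := by module
  have h1 := hγl.dist_le_mul x hx y hy
  rw [Real.dist_eq] at h1
  have hΓ' : |γ y| ≤ Γ.toNNReal := (hΓ y hy).trans (Real.le_coe_toNNReal Γ)
  rw [dist_eq_norm, e1, NNReal.coe_add, NNReal.coe_mul]
  calc ‖(γ x - γ y) • (P - x) + γ y • (y - x)‖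
      ≤ |γ x - γ y| * ‖P - x‖ + |γ y| * ‖y - x‖ := by
        refine (norm_add_le _ _).trans ?_
        rw [norm_smul, norm_smul, Real.norm_eq_abs, Real.norm_eq_abs]
    _ ≤ (Mγ * dist x y) * Q + Γ.toNNReal * dist x y := by
        rw [← dist_eq_norm y x, dist_comm y x]
        have := hP x hx
        gcongr
    _ = (Mγ * Q + Γ.toNNReal) * dist x y := by ring

/-- Pointwise form of the comparison between `∇u` and the slope `p` of `ℓ = c + ⟪p, ·⟫`, given the
lower bound `h` on the distance of `‖·‖ ^ q / q` from its tangent at `p`. -/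
theorem integrand_affine_sub_le {lam Γ σ s c : ℝ} {p P x : EuclideanSpace ℝ (Fin n)}
    (hlam : 0 < lam) (hγx : lam ≤ γ x) (hγx' : γ x ≤ Γ) (hσ : 0 ≤ σ) (hs : 0 ≤ s)
    (hf : 0 ≤ c + inner ℝ p x - u x)
    (h : ‖p‖ ^ q / q + inner ℝ P (gradient u x - p) + σ * (‖gradient u x - p‖ - s) ≤
      ‖gradient u x‖ ^ q / q) :
    (‖p‖ ^ q / q - inner ℝ x p + (c + inner ℝ p x)) * γ x - integrand q γ u x ≤
      inner ℝ (p - gradient u x) (γ x • (P - x)) + Γ * (c + inner ℝ p x - u x) -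
        σ * (lam * ‖p - gradient u x‖ - Γ * s) := by
  have hγ0 : 0 < γ x := hlam.trans_le hγx
  set g := gradient u x with hg
  have e2 : g - p = -(p - g) := by abel
  rw [norm_sub_rev g p, e2, inner_neg_right] at h
  have e3 : inner ℝ (p - g) (γ x • (P - x)) =
      γ x * (inner ℝ P (p - g) - inner ℝ x (p - g)) := by
    rw [inner_smul_right, inner_sub_right, real_inner_comm P, real_inner_comm x]
  have e4 : inner ℝ x g = inner ℝ x p - inner ℝ x (p - g) := by
    rw [← inner_sub_right]; congr 1; abel
  have h2 : (‖p‖ ^ q / q - inner ℝ x p + (c + inner ℝ p x)) * γ x - integrand q γ u x ≤ γ x *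
      (inner ℝ P (p - g) - inner ℝ x (p - g) + (c + inner ℝ p x - u x) - σ * (‖p - g‖ - s)) := by
    rw [integrand, ← hg, e4, ← sub_mul, mul_comm]
    exact mul_le_mul_of_nonneg_left (by linarith) hγ0.le
  have h3 : σ * (lam * ‖p - g‖ - Γ * s) ≤ σ * (γ x * (‖p - g‖ - s)) := by
    gcongr
    rw [mul_sub]
    gcongr
  have h4 : γ x * (c + inner ℝ p x - u x) ≤ Γ * (c + inner ℝ p x - u x) := by gcongr
  rw [e3]
  linarith

/-- Let `ℓ = c + ⟪p, ·⟫` be an affine function and `S = {u < ℓ}`. Minimality bounds the excess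
`∫_S (|∇u|^q / q - tangent at p) γ` by `∫_S ⟪∇(ℓ - u), b⟫ + ∫_S (ℓ - u) γ` with the Lipschitz field
`b = γ (‖p‖ ^ (q - 2) p - x)`, hence by a multiple of `∫_S (ℓ - u)`. -/
theorem IsMinimizer.exists_excess_le {a₀ : ℝ} {y₀ : EuclideanSpace ℝ (Fin n)}
    (hu : IsMinimizer q γ X a₀ y₀ u) (hXo : IsOpen X) (hXb : Bornology.IsBounded X)
    (hq : 1 < q) {Mγ : ℝ≥0} (hγl : LipschitzOnWith Mγ γ X)
    {lam Γ : ℝ} (hlam : 0 < lam) (hγ : ∀ x ∈ X, lam ≤ γ x) (hΓ : ∀ x ∈ X, γ x ≤ Γ) (hΓ0 : 0 < Γ)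
    {δ R : ℝ} (hδ : 0 < δ) (hR : 0 < R) :
    ∃ C > 0, ∀ (x₀ p : EuclideanSpace ℝ (Fin n)) (c h s : ℝ), Metric.closedBall x₀ δ ⊆ X →
      ‖p‖ ≤ R → 0 < c + inner ℝ p x₀ - u x₀ → (∀ x ∈ X, c + inner ℝ p x - u x ≤ h) →
      0 < s → s ≤ R → ∀ S, S = {x ∈ X | 0 < c + inner ℝ p x - u x} →
      IntegrableOn (fun x => p - gradient u x) S ∧
      s ^ (max q 2 - 1) * (lam * (∫ x in S, ‖p - gradient u x‖) - Γ * s * volume.real S) ≤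
        C * (h * volume.real S) := by
  obtain ⟨R₁, hR₁pos, hR₁⟩ := hXb.exists_pos_norm_le
  obtain ⟨c₀, hc₀, hexc⟩ := exists_norm_rpow_div_ge (E := EuclideanSpace ℝ (Fin n)) hq hR
  set Q := R ^ (q - 1) + R₁ with hQ
  have hQ0 : 0 < Q := by positivity
  set L : ℝ≥0 := Mγ * Q.toNNReal + Γ.toNNReal with hL
  set M := Γ * Q / δ with hM
  have hM0 : 0 < M := by positivity
  set K := M * (Module.finrank ℝ (EuclideanSpace ℝ (Fin n)) *
    (1 + lipschitzExtensionConstant (EuclideanSpace ℝ (Fin n)) * L / M) + 1) with hK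
  have hK0 : 0 < K := by positivity
  refine ⟨c₀⁻¹ * (K + Γ), by positivity, ?_⟩
  intro x₀ p c h s hball hp hfx₀ hfh hs hsR S hS
  obtain ⟨huc, hu0⟩ := hu.mem
  have hx₀ : x₀ ∈ X := hball (Metric.mem_closedBall_self hδ.le)
  have hγabs : ∀ x ∈ X, |γ x| ≤ Γ := fun x hx => by
    rw [abs_of_pos (hlam.trans_le (hγ x hx))]; exact hΓ x hx
  set f : EuclideanSpace ℝ (Fin n) → ℝ := fun x => c + inner ℝ p x - u x with hf
  have hfconc : ConcaveOn ℝ X f := concaveOn_const_add_inner_sub huc c p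
  have hSX : S ⊆ X := by rw [hS]; exact fun x hx => hx.1
  have hSo : IsOpen S := by
    have := (hfconc.continuousOn hXo).isOpen_inter_preimage hXo (isOpen_Ioi (a := (0 : ℝ)))
    rw [hS]; exact this
  have hSm := hSo.measurableSet
  have hfS : ∀ x ∈ S, 0 < f x := by rw [hS]; exact fun x hx => hx.2
  have hSfin : volume S < ⊤ := (hXb.subset hSX).measure_lt_top
  have hx₀S : x₀ ∈ S := by rw [hS]; exact ⟨hx₀, hfx₀⟩
  have hB : ∀ x ∈ S, |u x| ≤ (|a₀| + R₁ * ‖y₀‖) + (|c| + ‖p‖ * R₁) := fun x hx => by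
    have h1 := hu0 x (hSX hx)
    have h2 := hfS x hx
    have h3 : |inner ℝ x y₀| ≤ R₁ * ‖y₀‖ := (abs_real_inner_le_norm _ _).trans (by
      gcongr; exact hR₁ x (hSX hx))
    have h4 : |inner ℝ p x| ≤ ‖p‖ * R₁ := (abs_real_inner_le_norm _ _).trans (by
      gcongr; exact hR₁ x (hSX hx))
    have h5 := neg_abs_le a₀
    have h6 := le_abs_self c
    have h7 := (abs_le.1 h3).1
    have h8 := (abs_le.1 h4).2
    have : 0 ≤ |a₀| + R₁ * ‖y₀‖ := by positivity
    have : 0 ≤ |c| + ‖p‖ * R₁ := by positivity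
    simp only [hf] at h2
    rw [abs_le]
    constructor <;> linarith
  have hgi := integrableOn_gradient hq hXb hlam hγ hu.integrable hSm hSX hB
  set G : EuclideanSpace ℝ (Fin n) → EuclideanSpace ℝ (Fin n) := fun x => p - gradient u x with hG
  have hGi : IntegrableOn G S := (integrableOn_const hSfin.ne).sub hgi
  have hGgrad : ∀ᵐ x, x ∈ S → HasGradientAt f (G x) x := by
    filter_upwards [ae_hasGradientAt_const_add_inner_sub hXo huc c p] with x hx hxS
    exact hx (hSX hxS)
  refine ⟨hGi, ?_⟩
  set P := ‖p‖ ^ (q - 2) • p with hP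
  have hPn : ‖P‖ ≤ R ^ (q - 1) := by
    rcases eq_or_ne p 0 with h0 | h0
    · rw [hP, h0, smul_zero, norm_zero]; positivity
    · have hpos := norm_pos_iff.2 h0
      rw [hP, norm_smul, Real.norm_eq_abs, abs_of_pos (by positivity),
        ← Real.rpow_add_one hpos.ne']
      have : q - 2 + 1 = q - 1 := by ring
      rw [this]
      exact Real.rpow_le_rpow hpos.le hp (by linarith)
  set b : EuclideanSpace ℝ (Fin n) → EuclideanSpace ℝ (Fin n) := fun x => γ x • (P - x) with hb
  have hPx : ∀ x ∈ X, ‖P - x‖ ≤ Q := fun x hx =>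
    (norm_sub_le _ _).trans (add_le_add hPn (hR₁ x hx))
  have hbM : ∀ x ∈ X, ‖b x‖ ≤ M * δ := fun x hx => by
    have : M * δ = Γ * Q := by rw [hM]; field_simp
    rw [this, hb, norm_smul, Real.norm_eq_abs]
    exact mul_le_mul (hγabs x hx) (hPx x hx) (norm_nonneg _) hΓ0.le
  have hbL : LipschitzOnWith L b X := by
    refine lipschitzOnWith_smul_sub hγl hγabs P fun x hx => ?_
    rw [Real.coe_toNNReal _ hQ0.le]
    exact hPx x hx
  have htrans := setIntegral_inner_le_of_lipschitzOnWith hXo hXb hfconc hfh hS hδ.le hball hfx₀.le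
    hGgrad hGi hbL hM0 hbM
  rw [← hK] at htrans
  have hfi : IntegrableOn f S := by
    refine IntegrableOn.of_bound hSfin
      (((hfconc.continuousOn hXo).mono hSX).aestronglyMeasurable hSm) h ?_
    filter_upwards [ae_restrict_mem hSm] with x hx
    rw [Real.norm_eq_abs, abs_of_pos (hfS x hx)]
    exact hfh x (hSX hx)
  have hfint : ∫ x in S, f x ≤ h * volume.real S := by
    have := setIntegral_mono_on hfi (integrableOn_const hSfin.ne : IntegrableOn (fun _ => h) S) hSm
      fun x hx => hfh x (hSX hx)
    rwa [setIntegral_const, smul_eq_mul, mul_comm] at this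
  obtain ⟨hki, hcmp⟩ := hu.setIntegral_integrand_le hXo hXb hγl.continuousOn hγabs c p hS
    ⟨x₀, hx₀S⟩
  set k : EuclideanSpace ℝ (Fin n) → ℝ :=
    fun x => (‖p‖ ^ q / q - inner ℝ x p + (c + inner ℝ p x)) * γ x with hk
  have hbi : IntegrableOn (fun x => inner ℝ (G x) (b x)) S := by
    refine Integrable.mono' (hGi.norm.mul_const (M * δ)) ?_ ?_
    · refine hGi.aestronglyMeasurable.inner ?_
      have := hγl.continuousOn.mono hSX
      exact (by fun_prop : ContinuousOn b S).aestronglyMeasurable hSm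
    · filter_upwards [ae_restrict_mem hSm] with x hx
      exact (norm_inner_le_norm _ _).trans (by gcongr; exact hbM x (hSX hx))
  set σ := c₀ * s ^ (max q 2 - 1) with hσ
  have hσ0 : 0 < σ := by positivity
  have hpt : ∀ x ∈ S, k x - integrand q γ u x ≤
      inner ℝ (G x) (b x) + Γ * f x - σ * (lam * ‖G x‖ - Γ * s) := fun x hx => by
    have h1 := hexc p (gradient u x) s hp hs hsR
    rw [← hP, ← hσ] at h1
    exact integrand_affine_sub_le hlam (hγ x (hSX hx)) (hΓ x (hSX hx)) hσ0.le hs.le (hfS x hx).le h1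
  have hcs : IntegrableOn (fun _ : EuclideanSpace ℝ (Fin n) => Γ * s) S :=
    integrableOn_const hSfin.ne
  have hA : IntegrableOn (fun x => inner ℝ (G x) (b x) + Γ * f x) S := hbi.add (hfi.const_mul Γ)
  have hD : IntegrableOn (fun x => σ * (lam * ‖G x‖ - Γ * s)) S :=
    ((hGi.norm.const_mul lam).sub hcs).const_mul σ
  have huS := hu.integrable.mono_set hSX
  have hint : ∫ x in S, (k x - integrand q γ u x) ≤
      ∫ x in S, (inner ℝ (G x) (b x) + Γ * f x - σ * (lam * ‖G x‖ - Γ * s)) :=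
    setIntegral_mono_on (hki.sub huS) (hA.sub hD) hSm hpt
  have hE : ∫ x in S, (lam * ‖G x‖ - Γ * s) =
      lam * (∫ x in S, ‖G x‖) - Γ * s * volume.real S := by
    rw [integral_sub (hGi.norm.const_mul lam) hcs, integral_const_mul, setIntegral_const,
      smul_eq_mul]
    ring
  rw [integral_sub hki huS, integral_sub hA hD, integral_add hbi (hfi.const_mul Γ),
    integral_const_mul, integral_const_mul, hE] at hint
  have hfin : σ * (lam * (∫ x in S, ‖G x‖) - Γ * s * volume.real S) ≤
      (K + Γ) * (h * volume.real S) := by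
    have : (K + Γ) * ∫ x in S, f x ≤ (K + Γ) * (h * volume.real S) := by gcongr
    linarith
  rw [mul_assoc c₀⁻¹, ← div_eq_inv_mul, le_div_iff₀ hc₀]
  rw [hσ] at hfin
  linarith

end

/-! ### Deviation of a minimizer from its supporting affine functions -/

section

theorem norm_subgradient_le {E : Type*} [NormedAddCommGroup E] [InnerProductSpace ℝ E]
    {u : E → ℝ} {x p : E} {ρ B : ℝ} (hρ : 0 < ρ)
    (hB : ∀ y ∈ Metric.closedBall x ρ, |u y| ≤ B)
    (hp : ∀ y ∈ Metric.closedBall x ρ, u x + inner ℝ p (y - x) ≤ u y) : ‖p‖ ≤ 2 * B / ρ := by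
  have hB0 : 0 ≤ B := (abs_nonneg _).trans (hB x (Metric.mem_closedBall_self hρ.le))
  rcases eq_or_ne p 0 with rfl | h0
  · rw [norm_zero]; positivity
  have hpos := norm_pos_iff.2 h0
  have hy : x + (ρ / ‖p‖) • p ∈ Metric.closedBall x ρ := by
    rw [Metric.mem_closedBall, dist_eq_norm, add_sub_cancel_left, norm_smul, Real.norm_eq_abs,
      abs_of_pos (by positivity)]
    field_simp; exact le_rfl
  have h1 := hp _ hy
  rw [add_sub_cancel_left, inner_smul_right, real_inner_self_eq_norm_sq] at h1
  have h2 : ρ / ‖p‖ * ‖p‖ ^ 2 = ρ * ‖p‖ := by field_simp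
  have h3 := (abs_le.1 (hB _ hy)).2
  have h4 := (abs_le.1 (hB x (Metric.mem_closedBall_self hρ.le))).1
  rw [h2] at h1
  rw [le_div_iff₀ hρ]
  linarith

variable {n : ℕ} {X : Set (EuclideanSpace ℝ (Fin n))} {q : ℝ}
  {γ u : EuclideanSpace ℝ (Fin n) → ℝ}

/-- Let `w ≥ 0` vanish at `x₀`, let `h > 0` be its maximum over the ball of radius `r` about `x₀`,
attained at `x₁`, and let `p₁` be a subgradient of `w` at `x₁`.
Then `p₁` is a positive multiple of `e = (x₁ - x₀) / r`, so that `w ≥ h` beyond the hyperplane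
through `x₁` normal to `e`. Consequently the affine function `h / 2 + h / (2 r) ⟪e, x - x₀⟫` exceeds
`w` only within the slab `|⟪e, x - x₀⟫| < r`. -/
theorem exists_slab {E : Type*} [NormedAddCommGroup E] [InnerProductSpace ℝ E]
    {X : Set E} {w : E → ℝ} {x₀ x₁ p₁ : E} {r h : ℝ} (hr : 0 < r) (hh : 0 < h)
    (hball : Metric.closedBall x₀ r ⊆ X) (hw : ∀ x ∈ X, 0 ≤ w x) (hw₀ : w x₀ = 0)
    (hx₁ : x₁ ∈ Metric.closedBall x₀ r)
    (hmax : ∀ x ∈ Metric.closedBall x₀ r, w x ≤ h)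
    (hp₁ : ∀ x ∈ X, h + inner ℝ p₁ (x - x₁) ≤ w x) :
    ∃ e : E, ‖e‖ = 1 ∧ ∀ x ∈ X, 0 < h / 2 + h / (2 * r) * inner ℝ e (x - x₀) - w x →
      |inner ℝ e (x - x₀)| < r := by
  have hx₀b : x₀ ∈ Metric.closedBall x₀ r := Metric.mem_closedBall_self hr.le
  have hp₁0 : p₁ ≠ 0 := by
    rintro rfl
    have := hp₁ x₀ (hball hx₀b)
    rw [inner_zero_left, hw₀] at this
    linarith
  set κ := ‖p₁‖ with hκ
  have hκ0 : 0 < κ := norm_pos_iff.2 hp₁0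
  set e := κ⁻¹ • p₁ with he
  have he1 : ‖e‖ = 1 := by
    rw [he, norm_smul, norm_inv, Real.norm_eq_abs, abs_of_pos hκ0, ← hκ, inv_mul_cancel₀ hκ0.ne']
  have hp₁e : p₁ = κ • e := by rw [he, smul_inv_smul₀ hκ0.ne']
  have hsplit : ∀ x, inner ℝ p₁ (x - x₁) =
      κ * (inner ℝ e (x - x₀) - inner ℝ e (x₁ - x₀)) := fun x => by
    rw [hp₁e, inner_smul_left, conj_trivial, ← inner_sub_right]
    congr 2; abel
  -- comparison with the value at `x₀ + r • e` shows that `x₁ - x₀` has maximal component along `e`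
  have hre : r ≤ inner ℝ e (x₁ - x₀) := by
    have hy : x₀ + r • e ∈ Metric.closedBall x₀ r := by
      rw [Metric.mem_closedBall, dist_eq_norm, add_sub_cancel_left, norm_smul, he1, mul_one,
        Real.norm_eq_abs, abs_of_pos hr]
    have h1 := hp₁ _ (hball hy)
    have h2 := hmax _ hy
    rw [hsplit, add_sub_cancel_left, inner_smul_right, real_inner_self_eq_norm_sq, he1] at h1
    have h3 : κ * (r - inner ℝ e (x₁ - x₀)) ≤ 0 := by
      norm_num at h1; linarith
    have := nonpos_of_mul_nonpos_right h3 hκ0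
    linarith
  have hre' : inner ℝ e (x₁ - x₀) = r := by
    refine le_antisymm ((real_inner_le_norm _ _).trans ?_) hre
    rw [he1, one_mul, ← dist_eq_norm]
    exact hx₁
  have hκr : h ≤ κ * r := by
    have h1 := hp₁ x₀ (hball hx₀b)
    rw [hsplit, hre', sub_self, inner_zero_right, hw₀] at h1
    linarith
  refine ⟨e, he1, fun x hx hpos => ?_⟩
  set t := inner ℝ e (x - x₀) with ht
  have e1 : h / 2 + h / (2 * r) * t = h / (2 * r) * (t + r) := by field_simp; ring
  have hc : 0 < h / (2 * r) := by positivity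
  rw [abs_lt]
  constructor
  · have h1 := hw x hx
    have h2 : 0 < h / (2 * r) * (t + r) := by linarith
    have := pos_of_mul_pos_right h2 hc.le
    linarith
  · by_contra hcon
    rw [not_lt] at hcon
    have h1 := hp₁ x hx
    rw [hsplit, hre', ← ht] at h1
    have h2 : h / r * (t - r) ≤ κ * (t - r) := by
      have : h / r ≤ κ := (div_le_iff₀ hr).2 hκr
      have : 0 ≤ t - r := by linarith
      gcongr
    have h3 : h / (2 * r) * (t - r) ≤ h / r * (t - r) := by
      have : 0 ≤ t - r := by linarith
      gcongr
      linarith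
    have h4 : h / (2 * r) * (t + r) = h + h / (2 * r) * (t - r) := by field_simp; ring
    linarith

theorem exists_upper_bound (hXb : Bornology.IsBounded X) {Mγ : ℝ≥0} (hγl : LipschitzOnWith Mγ γ X)
    {lam : ℝ} (hlam : 0 < lam) (hγ : ∀ x ∈ X, lam ≤ γ x) :
    ∃ Γ : ℝ, 0 < Γ ∧ lam ≤ Γ ∧ ∀ x ∈ X, γ x ≤ Γ := by
  rcases X.eq_empty_or_nonempty with rfl | ⟨z, hz⟩
  · exact ⟨lam, hlam, le_rfl, fun x hx => absurd hx (notMem_empty x)⟩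
  · obtain ⟨D, hD⟩ := Metric.isBounded_iff.1 hXb
    have hD0 : 0 ≤ D := dist_nonneg.trans (hD hz hz)
    have hMD : 0 ≤ Mγ * D := by positivity
    have hz' := hγ z hz
    refine ⟨γ z + Mγ * D, by linarith, by linarith, fun x hx => ?_⟩
    have h1 := hγl.dist_le_mul x hx z hz
    have h2 : (Mγ : ℝ) * dist x z ≤ Mγ * D := by gcongr; exact hD hx hz
    rw [Real.dist_eq] at h1
    linarith [le_abs_self (γ x - γ z)]

/-- The scaling step: `h ~ r s` and `s ^ m ≲ h / s` give `s ≲ r ^ (1 / m)`, hence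
`h ≲ r ^ (1 + 1 / m)`. -/
theorem le_rpow_of_excess_le {C D Γ r s V h m : ℝ} (hC : 0 < C) (hD : 0 < D) (hΓ : 0 < Γ)
    (hr : 0 < r) (hs : 0 < s) (hV : 0 < V) (hm : 0 < m) (hhs : h = D * r * s)
    (hle : s ^ m * (Γ * s * V) ≤ C * (h * V)) :
    h ≤ D * (C * D / Γ) ^ (1 / m) * r ^ (1 + 1 / m) := by
  have h2 : s ^ m ≤ C * D / Γ * r := by
    have h3 : s ^ m * (Γ * s * V) ≤ (C * D / Γ * r) * (Γ * s * V) := by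
      refine hle.trans (le_of_eq ?_)
      rw [hhs]; field_simp
    exact le_of_mul_le_mul_right h3 (by positivity)
  have h3 : s ≤ (C * D / Γ * r) ^ (1 / m) := by
    have := Real.rpow_le_rpow (by positivity) h2 (by positivity : 0 ≤ 1 / m)
    rwa [← Real.rpow_mul hs.le, mul_one_div_cancel hm.ne', Real.rpow_one] at this
  calc h = D * r * s := hhs
    _ ≤ D * r * (C * D / Γ * r) ^ (1 / m) := by gcongr
    _ = D * (C * D / Γ) ^ (1 / m) * r ^ (1 + 1 / m) := by
      rw [Real.mul_rpow (by positivity) hr.le, Real.rpow_add hr, Real.rpow_one]; ring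

/-- The deviation of a minimizer from a supporting affine function at `x₀` is
`O(|x - x₀| ^ (1 + α))` with `α = 1 / (max q 2 - 1)`, locally uniformly in `x₀`. -/
theorem IsMinimizer.exists_sub_tangent_le {a₀ : ℝ} {y₀ : EuclideanSpace ℝ (Fin n)}
    (hu : IsMinimizer q γ X a₀ y₀ u) (hXo : IsOpen X) (hXb : Bornology.IsBounded X)
    (hq : 1 < q) {Mγ : ℝ≥0} (hγl : LipschitzOnWith Mγ γ X)
    {lam : ℝ} (hlam : 0 < lam) (hγ : ∀ x ∈ X, lam ≤ γ x) {δ B : ℝ} (hδ : 0 < δ) :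
    ∃ C, ∀ x₀ p₀ : EuclideanSpace ℝ (Fin n), Metric.closedBall x₀ δ ⊆ X →
      (∀ y ∈ Metric.closedBall x₀ δ, |u y| ≤ B) →
      (∀ y ∈ X, u x₀ + inner ℝ p₀ (y - x₀) ≤ u y) →
      ∀ x, ‖x - x₀‖ ≤ δ / 8 →
        u x - u x₀ - inner ℝ p₀ (x - x₀) ≤ C * ‖x - x₀‖ ^ (1 + 1 / (max q 2 - 1)) := by
  obtain ⟨huc, -⟩ := hu.mem
  obtain ⟨Γ, hΓ0, hlamΓ, hΓ⟩ := exists_upper_bound hXb hγl hlam hγ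
  set R := 6 * |B| / δ + 1 with hR
  have hR0 : 0 < R := by positivity
  obtain ⟨C, hC, hexc⟩ := hu.exists_excess_le hXo hXb hq hγl hlam hγ hΓ hΓ0 hδ hR0
  set N := Module.finrank ℝ (EuclideanSpace ℝ (Fin n)) with hN
  set ν := (2⁻¹ : ℝ) ^ N with hν
  have hν0 : 0 < ν := by positivity
  have hν1 : ν ≤ 1 := pow_le_one₀ (by norm_num) (by norm_num)
  set α := 1 / (max q 2 - 1) with hα
  have hm : 0 < max q 2 - 1 := by have := le_max_right q 2; linarith
  have hα0 : 0 < α := by positivity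
  set D := 16 * Γ / (lam * ν) with hD
  have hD0 : 0 < D := by positivity
  refine ⟨D * (C * D / Γ) ^ α, fun x₀ p₀ hball hB hp₀ x hx => ?_⟩
  set r := ‖x - x₀‖ with hr
  rcases (norm_nonneg (x - x₀)).eq_or_lt with hr0 | hr0
  · have hx₀ : x = x₀ := by rw [← sub_eq_zero, ← norm_eq_zero]; exact hr0.symm
    rw [hx₀, sub_self, sub_self, inner_zero_right, sub_zero]
    positivity
  rw [← hr] at hr0
  have hballr : Metric.closedBall x₀ r ⊆ Metric.closedBall x₀ δ :=
    Metric.closedBall_subset_closedBall (by linarith)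
  have hballX := hballr.trans hball
  set w : EuclideanSpace ℝ (Fin n) → ℝ := fun y => u y - u x₀ - inner ℝ p₀ (y - x₀) with hw
  have hw0 : ∀ y ∈ X, 0 ≤ w y := fun y hy => by
    have := hp₀ y hy
    simp only [hw]; linarith
  have hwx₀ : w x₀ = 0 := by simp [hw]
  have hwc : ContinuousOn w (Metric.closedBall x₀ r) := by
    have := (huc.continuousOn hXo).mono hballX
    fun_prop
  -- the maximum of `w` over the whole ball is estimated, not just `w x`
  obtain ⟨x₁, hx₁, hmax⟩ := (isCompact_closedBall x₀ r).exists_isMaxOn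
    ⟨x₀, Metric.mem_closedBall_self hr0.le⟩ hwc
  set h := w x₁ with hh
  have hxb : x ∈ Metric.closedBall x₀ r := by rw [Metric.mem_closedBall, dist_eq_norm]
  have hwh : w x ≤ h := hmax hxb
  refine hwh.trans ?_
  rcases le_or_gt h 0 with hh0 | hh0
  · exact hh0.trans (by positivity)
  obtain ⟨p₁', hp₁'⟩ := exists_subgradient hXo huc (hballX hx₁)
  obtain ⟨e, he, hslab⟩ := exists_slab (p₁ := p₁' - p₀) hr0 hh0 hballX hw0 hwx₀ hx₁
    (fun y hy => hmax hy) (fun y hy => by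
      have h1 := hp₁' y hy
      have e1 : inner ℝ p₀ (y - x₀) = inner ℝ p₀ (y - x₁) + inner ℝ p₀ (x₁ - x₀) := by
        rw [← inner_add_right]; congr 1; abel
      rw [hh, inner_sub_left]
      simp only [hw]
      linarith)
  have hBabs : ∀ y ∈ Metric.closedBall x₀ δ, |u y| ≤ |B| := fun y hy =>
    (hB y hy).trans (le_abs_self B)
  have hp₀n : ‖p₀‖ ≤ 2 * |B| / δ := norm_subgradient_le hδ hBabs fun y hy => hp₀ y (hball hy)
  have hball₁ : Metric.closedBall x₁ (δ / 2) ⊆ Metric.closedBall x₀ δ := by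
    refine Metric.closedBall_subset_closedBall' ?_
    have : dist x₁ x₀ ≤ r := hx₁
    linarith
  have hp₁n : ‖p₁'‖ ≤ 2 * |B| / (δ / 2) := norm_subgradient_le (by positivity)
    (fun y hy => hBabs y (hball₁ hy)) fun y hy => hp₁' y (hball (hball₁ hy))
  -- `u` is Lipschitz near `x₀`, so `h / r`, and with it the slope `p` below, stays bounded
  have hhr : h ≤ 6 * |B| / δ * r := by
    have h1 := hp₁' x₀ (hball (Metric.mem_closedBall_self hδ.le))
    have e1 : inner ℝ p₁' (x₀ - x₁) = -inner ℝ p₁' (x₁ - x₀) := by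
      rw [← inner_neg_right]; congr 1; abel
    have h2 : inner ℝ (p₁' - p₀) (x₁ - x₀) ≤ (‖p₁'‖ + ‖p₀‖) * r := by
      refine (real_inner_le_norm _ _).trans ?_
      gcongr
      · exact norm_sub_le _ _
      · rw [← dist_eq_norm]; exact hx₁
    rw [inner_sub_left] at h2
    have h3 : (‖p₁'‖ + ‖p₀‖) * r ≤ 6 * |B| / δ * r := by
      gcongr
      calc ‖p₁'‖ + ‖p₀‖ ≤ 2 * |B| / (δ / 2) + 2 * |B| / δ := add_le_add hp₁n hp₀n
        _ = 6 * |B| / δ := by field_simp; ring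
    rw [e1] at h1
    simp only [hh, hw]
    linarith
  set p := p₀ + (h / (2 * r)) • e with hp
  have hpn : ‖p‖ ≤ R := by
    have h1 : ‖(h / (2 * r)) • e‖ ≤ 3 * |B| / δ := by
      rw [norm_smul, he, mul_one, Real.norm_eq_abs, abs_of_pos (by positivity),
        div_le_iff₀ (by positivity)]
      calc h ≤ 6 * |B| / δ * r := hhr
        _ = _ := by ring
    have h2 : 2 * |B| / δ + 3 * |B| / δ ≤ 6 * |B| / δ := by
      rw [← add_div]; gcongr; linarith [abs_nonneg B]
    exact (norm_add_le _ _).trans (by linarith)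
  -- the affine function `c + ⟪p, ·⟫` is the supporting one plus that of `exists_slab`
  set c := u x₀ + h / 2 - inner ℝ p x₀ with hc
  have hf : ∀ y, c + inner ℝ p y - u y = h / 2 + h / (2 * r) * inner ℝ e (y - x₀) - w y := by
    intro y
    have e1 : inner ℝ p (y - x₀) = inner ℝ p₀ (y - x₀) + h / (2 * r) * inner ℝ e (y - x₀) := by
      rw [hp, inner_add_left, inner_smul_left, conj_trivial]
    rw [inner_sub_right] at e1
    simp only [hc, hw]
    linarith
  have hfx₀ : c + inner ℝ p x₀ - u x₀ = h / 2 := by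
    rw [hf, hwx₀]; simp
  set S := {y ∈ X | 0 < c + inner ℝ p y - u y} with hS
  have hfh : ∀ y ∈ X, c + inner ℝ p y - u y ≤ h := by
    intro y hy
    by_contra hcon
    rw [not_le] at hcon
    have h1 := (abs_lt.1 (hslab y hy (by rw [← hf]; linarith))).2
    have h2 := hw0 y hy
    have h3 : h / (2 * r) * inner ℝ e (y - x₀) ≤ h / (2 * r) * r := by gcongr
    have h4 : h / (2 * r) * r = h / 2 := by field_simp
    rw [hf] at hcon
    linarith
  have hx₀X : x₀ ∈ X := hball (Metric.mem_closedBall_self hδ.le)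
  have hSX : S ⊆ X := fun y hy => hy.1
  have hfconc := concaveOn_const_add_inner_sub huc c p
  have hSo : IsOpen S := (hfconc.continuousOn hXo).isOpen_inter_preimage hXo
    (isOpen_Ioi (a := (0 : ℝ)))
  have hSfin : volume S < ⊤ := (hXb.subset hSX).measure_lt_top
  have hSpos : 0 < volume.real S := by
    rw [measureReal_def]
    refine ENNReal.toReal_pos (hSo.measure_pos volume ⟨x₀, hx₀X, ?_⟩).ne' hSfin.ne
    rw [hfx₀]; positivity
  -- chosen so that `Γ s` is half of the lower bound for the mean of `lam * ‖∇(ℓ - u)‖`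
  set s := h / (D * r) with hs
  have hs0 : 0 < s := by positivity
  have hhs : h = D * r * s := by rw [hs]; field_simp
  have hsR : s ≤ R := by
    have h1 : 1 ≤ D := by
      rw [hD, le_div_iff₀ (by positivity)]
      nlinarith
    have h2 : s ≤ h / r := by
      rw [hs]
      apply div_le_div_of_nonneg_left hh0.le hr0
      nlinarith
    have h3 : h / r ≤ 6 * |B| / δ := (div_le_iff₀ hr0).2 hhr
    linarith
  obtain ⟨hGi, hmain⟩ := hexc x₀ p c h s hball hpn (by rw [hfx₀]; positivity) hfh hs0 hsR S hS
  have hGgrad : ∀ᵐ y, y ∈ S → HasGradientAt (fun y => c + inner ℝ p y - u y)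
      (p - gradient u y) y := by
    filter_upwards [ae_hasGradientAt_const_add_inner_sub hXo huc c p] with y hy hyS
    exact hy (hSX hyS)
  have hlow := mul_volume_le_integral_norm_gradient hXo hXb hfconc hS he (c := h / 2) hr0
    (by linarith) (by positivity) hball hfx₀.ge
    (fun y hy => hslab y hy.1 (by rw [← hf]; exact hy.2)) hGgrad hGi
  rw [← hν] at hlow
  have hlow2 : 2 * Γ * s * volume.real S ≤ lam * ∫ y in S, ‖p - gradient u y‖ := by
    refine le_trans (le_of_eq ?_) (mul_le_mul_of_nonneg_left hlow hlam.le)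
    rw [hs, hD]; field_simp; ring
  refine le_rpow_of_excess_le hC hD0 hΓ0 hr0 hs0 hSpos hm hhs (le_trans ?_ hmain)
  exact mul_le_mul_of_nonneg_left (by linarith) (by positivity)

end

/-! ### From tangent estimates to Hölder continuous gradients -/

section

theorem hasGradientAt_of_abs_sub_le {E : Type*} [NormedAddCommGroup E] [InnerProductSpace ℝ E]
    [CompleteSpace E] {u : E → ℝ} {x₀ p₀ : E} {C α ρ : ℝ} (hα : 0 < α) (hρ : 0 < ρ)
    (h : ∀ x, ‖x - x₀‖ ≤ ρ → |u x - u x₀ - inner ℝ p₀ (x - x₀)| ≤ C * ‖x - x₀‖ ^ (1 + α)) :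
    HasGradientAt u p₀ x₀ := by
  rw [hasGradientAt_iff_isLittleO, Asymptotics.isLittleO_iff]
  intro ε hε
  have hc : Tendsto (fun x : E => C * ‖x - x₀‖ ^ α) (𝓝 x₀) (𝓝 0) := by
    have h1 : Tendsto (fun x : E => ‖x - x₀‖) (𝓝 x₀) (𝓝 0) := by
      have : Continuous fun x : E => ‖x - x₀‖ := by fun_prop
      simpa using this.tendsto x₀
    have h2 := (h1.rpow_const (p := α) (Or.inr hα.le)).const_mul C
    rwa [Real.zero_rpow hα.ne', mul_zero] at h2
  filter_upwards [hc.eventually_lt_const hε, Metric.closedBall_mem_nhds x₀ hρ] with x hx hxb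
  rw [Metric.mem_closedBall, dist_eq_norm] at hxb
  rw [Real.norm_eq_abs]
  refine (h x hxb).trans ?_
  rw [Real.rpow_add' (norm_nonneg _) (by positivity), Real.rpow_one, mul_left_comm, mul_comm]
  gcongr

/-- Upper tangent estimates at `x` together with lower tangent estimates at `x` and `y` control the
difference of the gradients: test them at the point `z = y + |x - y| ω`, with `ω` the direction of
`∇u(y) - ∇u(x)`. -/
theorem norm_sub_le_of_tangent_le {E : Type*} [NormedAddCommGroup E] [InnerProductSpace ℝ E]
    {u : E → ℝ} {x y px py : E} {C α ρ : ℝ} (hα : 0 ≤ α) (hC : 0 ≤ C) (hxy : 0 < ‖x - y‖)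
    (hρ : 2 * ‖x - y‖ ≤ ρ)
    (hx : ∀ z, ‖z - x‖ ≤ ρ → u z - u x - inner ℝ px (z - x) ≤ C * ‖z - x‖ ^ (1 + α))
    (hx' : u x + inner ℝ px (y - x) ≤ u y)
    (hy : ∀ z, ‖z - x‖ ≤ ρ → u y + inner ℝ py (z - y) ≤ u z) :
    ‖px - py‖ ≤ C * 2 ^ (1 + α) * ‖x - y‖ ^ α := by
  rcases eq_or_ne py px with h0 | h0
  · rw [h0, sub_self, norm_zero]; positivity
  have hv : 0 < ‖py - px‖ := norm_pos_iff.2 (sub_ne_zero.2 h0)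
  set r := ‖x - y‖ with hr
  set z := y + (r / ‖py - px‖) • (py - px) with hz
  have hzy : ‖z - y‖ = r := by
    rw [hz, add_sub_cancel_left, norm_smul, Real.norm_eq_abs, abs_of_pos (by positivity)]
    field_simp
  have hzx : ‖z - x‖ ≤ 2 * r := by
    have : z - x = (z - y) + (y - x) := by abel
    rw [this]
    refine (norm_add_le _ _).trans ?_
    rw [hzy, norm_sub_rev y x]
    linarith
  have h1 := hx z (hzx.trans hρ)
  have h2 := hy z (hzx.trans hρ)
  have e1 : inner ℝ px (z - x) = inner ℝ px (z - y) + inner ℝ px (y - x) := by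
    rw [← inner_add_right]; congr 1; abel
  have e2 : inner ℝ (py - px) (z - y) = r * ‖py - px‖ := by
    rw [hz, add_sub_cancel_left, inner_smul_right, real_inner_self_eq_norm_sq]
    field_simp
  rw [inner_sub_left] at e2
  have h3 : C * ‖z - x‖ ^ (1 + α) ≤ C * (2 * r) ^ (1 + α) := by gcongr
  have h4 : (2 * r) ^ (1 + α) = 2 ^ (1 + α) * (r * r ^ α) := by
    rw [Real.mul_rpow (by norm_num) hxy.le, Real.rpow_add hxy, Real.rpow_one]
  rw [norm_sub_rev]
  have h5 : r * ‖py - px‖ ≤ r * (C * 2 ^ (1 + α) * r ^ α) := by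
    rw [h4] at h3
    linarith
  exact le_of_mul_le_mul_left h5 hxy

theorem exists_closedBall_subset_and_bound {E : Type*} [NormedAddCommGroup E] [NormedSpace ℝ E]
    [FiniteDimensional ℝ E] {X K : Set E} {u : E → ℝ} (hX : IsOpen X) (hu : ContinuousOn u X)
    (hK : IsCompact K) (hKX : K ⊆ X) :
    ∃ δ > 0, ∃ B, ∀ x ∈ K, Metric.closedBall x δ ⊆ X ∧
      ∀ y ∈ Metric.closedBall x δ, |u y| ≤ B := by
  have := FiniteDimensional.proper ℝ E
  obtain ⟨δ, hδ, hsub⟩ := hK.exists_cthickening_subset_open hX hKX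
  obtain ⟨B, hB⟩ := hK.cthickening.exists_bound_of_continuousOn (hu.mono hsub)
  exact ⟨δ, hδ, B, fun x hx =>
    ⟨(Metric.closedBall_subset_cthickening hx δ).trans hsub,
      fun y hy => hB y (Metric.closedBall_subset_cthickening hx δ hy)⟩⟩

theorem holderOnWith_of_dist_le {Y Z : Type*} [PseudoMetricSpace Y] [PseudoMetricSpace Z]
    {f : Y → Z} {K : Set Y} {C : ℝ} {α : ℝ≥0}
    (h : ∀ x ∈ K, ∀ y ∈ K, dist (f x) (f y) ≤ C * dist x y ^ (α : ℝ)) :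
    HolderOnWith C.toNNReal α f K := by
  intro x hx y hy
  have h1 : dist (f x) (f y) ≤ C.toNNReal * dist x y ^ (α : ℝ) :=
    (h x hx y hy).trans (by gcongr; exact Real.le_coe_toNNReal C)
  rw [edist_dist, edist_dist, ENNReal.ofReal_rpow_of_nonneg dist_nonneg α.coe_nonneg]
  refine (ENNReal.ofReal_le_ofReal h1).trans ?_
  rw [ENNReal.ofReal_mul (NNReal.coe_nonneg _), ENNReal.ofReal_coe_nnreal]

variable {n : ℕ} {X : Set (EuclideanSpace ℝ (Fin n))} {q : ℝ}
  {γ u : EuclideanSpace ℝ (Fin n) → ℝ}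

/-- A convex function whose deviation from supporting affine functions is `O(|x - x₀| ^ (1 + α))`,
locally uniformly in `x₀`, is of class `C^{1,α}_loc`. -/
theorem isC1HolderLoc_of_tangent_le (hX : IsOpen X) (hu : ConvexOn ℝ X u) {α : ℝ≥0} (hα : 0 < α)
    (h : ∀ δ > 0, ∀ B, ∃ C, ∀ x₀ p₀ : EuclideanSpace ℝ (Fin n), Metric.closedBall x₀ δ ⊆ X →
      (∀ y ∈ Metric.closedBall x₀ δ, |u y| ≤ B) →
      (∀ y ∈ X, u x₀ + inner ℝ p₀ (y - x₀) ≤ u y) →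
      ∀ x, ‖x - x₀‖ ≤ δ / 8 →
        u x - u x₀ - inner ℝ p₀ (x - x₀) ≤ C * ‖x - x₀‖ ^ (1 + (α : ℝ))) :
    IsC1HolderLoc α u X := by
  have hα' : (0 : ℝ) < α := hα
  -- On a compact set, `u` is differentiable with the estimates holding for its gradient.
  have hloc : ∀ K ⊆ X, IsCompact K → ∃ δ > 0, ∃ B C, 0 ≤ C ∧ ∀ x ∈ K,
      Metric.closedBall x δ ⊆ X ∧ DifferentiableAt ℝ u x ∧
      (∀ y ∈ X, u x + inner ℝ (gradient u x) (y - x) ≤ u y) ∧ ‖gradient u x‖ ≤ B ∧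
      ∀ y, ‖y - x‖ ≤ δ / 8 →
        u y - u x - inner ℝ (gradient u x) (y - x) ≤ C * ‖y - x‖ ^ (1 + (α : ℝ)) := by
    intro K hKX hK
    obtain ⟨δ, hδ, B, hB⟩ := exists_closedBall_subset_and_bound hX (hu.continuousOn hX) hK hKX
    obtain ⟨C, hC⟩ := h δ hδ B
    refine ⟨δ, hδ, 2 * B / δ, |C|, abs_nonneg C, fun x hx => ?_⟩
    obtain ⟨hball, hbd⟩ := hB x hx
    obtain ⟨p, hp⟩ := exists_subgradient hX hu (hKX hx)
    have hCx : ∀ y, ‖y - x‖ ≤ δ / 8 →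
        u y - u x - inner ℝ p (y - x) ≤ |C| * ‖y - x‖ ^ (1 + (α : ℝ)) := fun y hy =>
      (hC x p hball hbd hp y hy).trans (by gcongr; exact le_abs_self C)
    have hgrad : HasGradientAt u p x := by
      refine hasGradientAt_of_abs_sub_le hα' (by positivity : 0 < δ / 8) (C := |C|) fun y hy => ?_
      rw [abs_of_nonneg]
      · exact hCx y hy
      · have hyX : y ∈ X := hball (by rw [Metric.mem_closedBall, dist_eq_norm]; linarith)
        linarith [hp y hyX]
    rw [hgrad.gradient]
    exact ⟨hball, hgrad.differentiableAt, hp,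
      norm_subgradient_le hδ hbd fun y hy => hp y (hball hy), hCx⟩
  have hholder : ∀ K ⊆ X, IsCompact K → ∃ C : ℝ≥0, HolderOnWith C α (gradient u) K := by
    intro K hKX hK
    obtain ⟨δ, hδ, B, C, hC, hest⟩ := hloc K hKX hK
    refine ⟨_, holderOnWith_of_dist_le
      (C := C * 2 ^ (1 + (α : ℝ)) + 2 * |B| * (16 / δ) ^ (α : ℝ)) fun x hx y hy => ?_⟩
    obtain ⟨hbx, -, hsx, hnx, htx⟩ := hest x hx
    obtain ⟨-, -, hsy, hny, -⟩ := hest y hy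
    rw [dist_eq_norm, dist_eq_norm, add_mul]
    rcases (norm_nonneg (x - y)).eq_or_lt with h0 | h0
    · have : x = y := by rw [← sub_eq_zero, ← norm_eq_zero]; exact h0.symm
      rw [this, sub_self, norm_zero]
      positivity
    rcases le_total (2 * ‖x - y‖) (δ / 8) with hle | hle
    · have hzX : ∀ z, ‖z - x‖ ≤ δ / 8 → z ∈ X := fun z hz =>
        hbx (by rw [Metric.mem_closedBall, dist_eq_norm]; linarith)
      have := norm_sub_le_of_tangent_le hα'.le hC h0 hle htx (hsx y (hKX hy))
        fun z hz => hsy z (hzX z hz)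
      have : 0 ≤ 2 * |B| * (16 / δ) ^ (α : ℝ) * ‖x - y‖ ^ (α : ℝ) := by positivity
      linarith
    · have h1 : 1 ≤ 16 / δ * ‖x - y‖ := by
        rw [div_mul_eq_mul_div, le_div_iff₀ hδ]; linarith
      have h2 : 1 ≤ (16 / δ) ^ (α : ℝ) * ‖x - y‖ ^ (α : ℝ) := by
        rw [← Real.mul_rpow (by positivity) h0.le]
        exact Real.one_le_rpow h1 hα'.le
      have h3 : ‖gradient u x - gradient u y‖ ≤ 2 * |B| :=
        (norm_sub_le _ _).trans (by linarith [le_abs_self B])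
      have h4 : 2 * |B| * 1 ≤ 2 * |B| * ((16 / δ) ^ (α : ℝ) * ‖x - y‖ ^ (α : ℝ)) := by gcongr
      have : 0 ≤ C * 2 ^ (1 + (α : ℝ)) * ‖x - y‖ ^ (α : ℝ) := by positivity
      linarith
  refine ⟨?_, hholder⟩
  have hdiff : DifferentiableOn ℝ u X := fun x hx => by
    obtain ⟨_, _, _, _, _, hest⟩ := hloc {x} (singleton_subset_iff.2 hx) isCompact_singleton
    exact (hest x rfl).2.1.differentiableWithinAt
  have hgc : ContinuousOn (gradient u) X := fun x hx => by
    obtain ⟨ε, hε, hεX⟩ := Metric.nhds_basis_closedBall.mem_iff.1 (hX.mem_nhds hx)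
    obtain ⟨C, hC⟩ := hholder _ hεX (isCompact_closedBall x ε)
    exact ((hC.continuousOn hα).continuousAt (Metric.closedBall_mem_nhds x hε)).continuousWithinAt
  have hfd : ContinuousOn (fderiv ℝ u) X := by
    rw [← toDual_comp_gradient]
    exact (InnerProductSpace.toDual ℝ _).continuous.comp_continuousOn hgc
  rw [show (1 : WithTop ℕ∞) = 0 + 1 by simp, contDiffOn_succ_iff_fderiv_of_isOpen hX]
  exact ⟨hdiff, by simp, contDiffOn_zero.2 hfd⟩

end

end RochetChone

theorem mainTheorem2 {n : ℕ} (X : Set (EuclideanSpace ℝ (Fin n)))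
    (hX_open : IsOpen X) (hX_bdd : Bornology.IsBounded X) (hX_conv : Convex ℝ X)
    (q : ℝ) (hq : 1 < q)
    (γ : EuclideanSpace ℝ (Fin n) → ℝ) (hγ_lip : ∃ M : ℝ≥0, LipschitzOnWith M γ X)
    (hγ_pos : ∃ lam : ℝ, 0 < lam ∧ ∀ x ∈ X, lam ≤ γ x)
    (a₀ : ℝ) (y₀ : EuclideanSpace ℝ (Fin n))
    (u : EuclideanSpace ℝ (Fin n) → ℝ)
    (hu : RochetChone.IsMinimizer q γ X a₀ y₀ u) :
    (2 < q → RochetChone.IsC1HolderLoc (1 / (q - 1)).toNNReal u X) ∧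
      (q ≤ 2 → RochetChone.IsC1HolderLoc 1 u X) := by
  obtain ⟨M, hM⟩ := hγ_lip
  obtain ⟨lam, hlam, hγ⟩ := hγ_pos
  have main : ∀ α : ℝ≥0, 0 < α → (α : ℝ) = 1 / (max q 2 - 1) →
      RochetChone.IsC1HolderLoc α u X := fun α hα hαq => by
    refine RochetChone.isC1HolderLoc_of_tangent_le hX_open hu.mem.1 hα fun δ hδ B => ?_
    rw [hαq]
    exact hu.exists_sub_tangent_le hX_open hX_bdd hq hM hlam hγ hδ
  refine ⟨fun h => main _ ?_ ?_, fun h => main 1 one_pos ?_⟩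
  · have : 0 < q - 1 := by linarith
    exact Real.toNNReal_pos.2 (by positivity)
  · have : 0 < q - 1 := by linarith
    rw [max_eq_left h.le, Real.coe_toNNReal _ (by positivity)]
  · rw [max_eq_right h]; norm_num
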